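/- Let $k$ be a field and let $\mathcal D$ be a $k$-linear triangulated category that is $2$-Calabi–Yau: all $\mathrm{Hom}$ spaces are finite dimensional and there are isomorphisms $\mathrm{Hom}(X,Y)\cong\mathrm{Hom}(Y,X[2])^{*}$, natural in $X$ and $Y$. Let $\mathcal B\subset\mathcal D$ be the heart of a bounded $t$-structure, with cohomology functors $H^i:\mathcal D\to\mathcal B$, and suppose that $\mathcal B$ is of finite length (every object has a finite filtration with simple quotients). Let $S\in\mathcal B$ be a simple object that is spherical: $\mathrm{Hom}(S,S[n])$ is one-dimensional for $n=0,2$ and zero for every other $n\in\mathbb Z$. For $F\in\mathcal D$, the spherical twist $T_S(F)$ is defined by a distinguished triangle $$\mathrm{RHom}(S,F)\otimes S\xrightarrow{\ \mathrm{ev}\ }F\to T_S(F)\to(\mathrm{RHom}(S,F)\otimes S)[1],\qquad \mathrm{RHom}(S,F)\otimes S=\bigoplus_{n\in\mathbb Z}\mathrm{Hom}(S[n],F)\otimes_k S[n],$$ where $\mathrm{ev}$ is the evaluation morphism. Let $\langle S\rangle\subset\mathcal B$ be the full subcategory of objects having a finite filtration with all quotients isomorphic to $S$, and define the left and right tilts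 of $\mathcal B$ at $S$ as the full subcategories $$L_S\mathcal B=\{F\in\mathcal D: H^i(F)=0\text{ for }i\neq 0,1,\ \mathrm{Hom}(S,H^0(F))=0,\ H^1(F)\in\langle S\rangle\},$$ $$R_S\mathcal B=\{F\in\mathcal D: H^i(F)=0\text{ for }i\neq -1,0,\ H^{-1}(F)\in\langle S\rangle,\ \mathrm{Hom}(H^0(F),S)=0\}.$$ Then $T_S(F)$ exists for every $F\in\mathcal D$ and is unique up to isomorphism, and the twist realizes tilting at $S$: $$T_S(\mathcal B)=L_S\mathcal B\qquad\text{and}\qquad T_S^{-1}(\mathcal B)=R_S\mathcal B .$$ Here $T_S(\mathcal B)$ is the class of objects isomorphic to $T_S(F)$ for some $F\in\mathcal B$, and $T_S^{-1}(\mathcal B)$ is the class of objects $F$ with $T_S(F)\in\mathcal B$. Consequently, for every autoequivalence $T$ of $\mathcal D$ such that $T(F)$ is a twist $T_S(F)$ for each $F\in\mathcal D$, the essential images of $\mathcal B$ under $T$ and under a quasi-inverse $T^{-1}$ are $T(\mathcal B)=L_S\mathcal B$ and $T^{-1}(\mathcal B)=R_S\mathcal B$. -/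

import Mathlib

open CategoryTheory CategoryTheory.Limits CategoryTheory.Pretriangulated
open CategoryTheory.Triangulated

namespace TwistTilt

section CalabiYau

/-- A `k`-linear triangulated category is `2`-Calabi-Yau if its `Hom` spaces are finite
dimensional and there are isomorphisms `Hom(X, Y) ≃ Hom(Y, X[2])*`, natural in `X` and in `Y`. -/
structure IsTwoCalabiYau (k : Type*) [Field k] (D : Type*) [Category* D] [Preadditive D]
    [Linear k D] [HasShift D ℤ] : Prop where
  finite_hom : ∀ X Y : D, Module.Finite k (X ⟶ Y)
  serre_duality : ∃ e : ∀ X Y : D, (X ⟶ Y) ≃ₗ[k] Module.Dual k (Y ⟶ X⟦(2 : ℤ)⟧),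
    (∀ (X X' Y : D) (a : X' ⟶ X) (f : X ⟶ Y) (g : Y ⟶ X'⟦(2 : ℤ)⟧),
      e X' Y (a ≫ f) g = e X Y f (g ≫ a⟦(2 : ℤ)⟧')) ∧
    (∀ (X Y Y' : D) (f : X ⟶ Y) (b : Y ⟶ Y') (g : Y' ⟶ X⟦(2 : ℤ)⟧),
      e X Y' (f ≫ b) g = e X Y f (b ≫ g))

/-- An object `S` is (2-)spherical if `Ext^n(S, S) = Hom(S, S[n])` is one dimensional for
`n = 0, 2` and zero for all other `n`. For degree reasons this is the same as saying that the
graded algebra `Ext^•(S, S)` is isomorphic to the cohomology algebra `k[x]/(x²)`, `deg x = 2`,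
of the `2`-sphere. -/
structure IsSpherical (k : Type*) [Field k] {D : Type*} [Category* D] [Preadditive D]
    [Linear k D] [HasShift D ℤ] (S : D) : Prop where
  finrank_zero : Module.finrank k (S ⟶ S⟦(0 : ℤ)⟧) = 1
  finrank_two : Module.finrank k (S ⟶ S⟦(2 : ℤ)⟧) = 1
  eq_zero : ∀ n : ℤ, n ≠ 0 → n ≠ 2 → ∀ f : S ⟶ S⟦n⟧, f = 0

end CalabiYau

section Twist

/-- `ev : P ⟶ F` is the evaluation morphism `RHom(S, F) ⊗ S ⟶ F`.
Here `RHom(S, F) ⊗ S = ⨁ n, Hom(S[n], F) ⊗ S[n]` is characterized by the universal property of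
the tensor products with vector spaces and of the direct sum: for each `n` there is a linear map
`ι n : Hom(S[n], F) → Hom(S[n], P)`, and the morphisms `P ⟶ Y` correspond by composition with
the `ι n` to the families of linear maps `Hom(S[n], F) → Hom(S[n], Y)`. The evaluation
morphism is the one which corresponds to the identity maps of the spaces `Hom(S[n], F)`. -/
def IsEvaluation (k : Type*) [Field k] {D : Type*} [Category* D] [Preadditive D]
    [Linear k D] [HasShift D ℤ] (S F P : D) (ev : P ⟶ F) : Prop :=
  ∃ ι : ∀ n : ℤ, (S⟦n⟧ ⟶ F) →ₗ[k] (S⟦n⟧ ⟶ P),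
    (∀ (Y : D) (φ : ∀ n : ℤ, (S⟦n⟧ ⟶ F) →ₗ[k] (S⟦n⟧ ⟶ Y)),
      ∃! p : P ⟶ Y, ∀ (n : ℤ) (f : S⟦n⟧ ⟶ F), ι n f ≫ p = φ n f) ∧
    (∀ (n : ℤ) (f : S⟦n⟧ ⟶ F), ι n f ≫ ev = f)

variable (k : Type*) [Field k] {D : Type*} [Category* D] [Preadditive D] [Linear k D]
  [HasZeroObject D] [HasShift D ℤ] [∀ n : ℤ, (shiftFunctor D n).Additive] [Pretriangulated D]

/-- `G` is (a model of) the twist `T_S(F)`: it sits in a distinguished triangle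
`RHom(S, F) ⊗ S ⟶ F ⟶ G ⟶ (RHom(S, F) ⊗ S)[1]` whose first map is the evaluation. -/
def IsTwist (S F G : D) : Prop :=
  ∃ (P : D) (ev : P ⟶ F) (η : F ⟶ G) (δ : G ⟶ P⟦(1 : ℤ)⟧),
    IsEvaluation k S F P ev ∧ Triangle.mk ev η δ ∈ distTriang D

/-- `T_S(B)`: the objects isomorphic to `T_S(F)` for some `F` in `B`. -/
def twistImage (S : D) (B : ObjectProperty D) : ObjectProperty D :=
  fun G ↦ ∃ F, B F ∧ IsTwist k S F G

/-- `T_S⁻¹(B)`: the objects `F` such that `T_S(F)` is in `B`. -/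
def twistPreimage (S : D) (B : ObjectProperty D) : ObjectProperty D :=
  fun F ↦ ∃ G, B G ∧ IsTwist k S F G

end Twist

section Tilt

variable {D : Type*} [Category* D] [Preadditive D] [HasZeroObject D] [HasShift D ℤ]
  [∀ n : ℤ, (shiftFunctor D n).Additive] [Pretriangulated D]

/-- The objects which are obtained from zero by finitely many successive extensions
`A ⟶ E ⟶ Q` with `Q` satisfying `P`. When the objects in `P` lie in the heart of a
t-structure, the distinguished triangles which appear are the short exact sequences
`0 → A → E → Q → 0` of the heart, so that this is the property of having a finite filtration
in the heart with all successive quotients in `P`. -/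
inductive Filtered (P : ObjectProperty D) : D → Prop
  | zero (X : D) (hX : IsZero X) : Filtered P X
  | step (A E Q : D) (f : A ⟶ E) (g : E ⟶ Q) (h : Q ⟶ A⟦(1 : ℤ)⟧)
      (hT : Triangle.mk f g h ∈ distTriang D) (hA : Filtered P A) (hQ : P Q) : Filtered P E

variable (t : TStructure D)

/-- `X` lies in the heart of `t`, and is a simple object of the heart. -/
def IsSimpleInHeart (X : D) : Prop :=
  ∃ hX : t.heart X, Simple (⟨X, hX⟩ : t.heart.FullSubcategory)

/-- The heart of `t` is of finite length: each of its objects has a finite filtration with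
simple quotients. -/
def IsFiniteLengthHeart : Prop :=
  ∀ X : D, t.heart X → Filtered (IsSimpleInHeart t) X

/-- `⟨S⟩`: the objects with a finite filtration with all quotients isomorphic to `S`. -/
def generatedBy (S : D) : ObjectProperty D :=
  Filtered (fun Q ↦ Nonempty (Q ≅ S))

/-- The cohomology object `H^n(F)` of `F` with respect to `t`, an object of the heart. -/
noncomputable def coh (n : ℤ) (F : D) : D :=
  ((t.truncGELE n n).obj F)⟦n⟧

/-- The left tilt of the heart of `t` at `S`. -/
def leftTilt (S : D) : ObjectProperty D := fun F ↦
  (∀ i : ℤ, i ≠ 0 → i ≠ 1 → IsZero (coh t i F)) ∧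
  (∀ f : S ⟶ coh t 0 F, f = 0) ∧ generatedBy S (coh t 1 F)

/-- The right tilt of the heart of `t` at `S`. -/
def rightTilt (S : D) : ObjectProperty D := fun F ↦
  (∀ i : ℤ, i ≠ -1 → i ≠ 0 → IsZero (coh t i F)) ∧
  generatedBy S (coh t (-1) F) ∧ (∀ f : coh t 0 F ⟶ S, f = 0)

end Tilt

end TwistTilt

/-!
A twist triangle is determined by its object `F`, and symmetrically by the twist `G`.
Choose a basis of each space `Hom(S[m], F)`; the evaluation morphism becomes `e : ⨁ S[n j] ⟶ F`,
where `m` occurs among the `n j` as many times as the dimension of `Hom(S[m], F)` (`IsEvBasis`).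
Let `G` be its cone, with connecting morphism `δ : G ⟶ (⨁ S[n j])[1]`. As `S` is spherical and `D` is
`2`-Calabi-Yau, the components of `δ` then form bases of the spaces `Hom(G, S[m][1])`
(`IsCoevBasis`), and conversely the cocone of such a coevaluation morphism is a twist triangle
(`IsEvBasis.isCoevBasis`, `IsCoevBasis.isEvBasis`). So the twist is invertible on objects, and in
each triangle the numbers `n j` can be bounded by the vanishing of morphisms from shifts of `S` to
`F` or from `G` to shifts of `S`, whichever of the two objects is known.

It remains to compare the t-structure with a twist triangle `⨁ S[n j] ⟶ F ⟶ G`. In a finite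
length heart the conditions `F ≤ 0` and `G ≥ 0` can be tested on the simple objects `T`
(`isLE_zero_of_homVanish_simple`, `isGE_zero_of_homVanish_simple`). For `T ≅ S` the test follows
from the duality and the bounds of the `n j`. For `T ≇ S` it follows from the long exact sequence,
as by Schur's lemma there are no nonzero morphisms between `S[a]` and `T[b]`, from the one to the
other, unless the target has the larger shift. When a tilt is twisted back to the heart, one case
is left over: morphisms `S[-2] ⟶ T[-1]` for the left tilt, and `T ⟶ S[1]` for the right tilt.
There the part in `⟨S⟩` of the object of the tilt intervenes. Since `Ext¹(S, S) = 0`, that part is a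
direct summand of a sum of copies of `S`, and it is identified with a part of `⨁ S[n j]`
(`IsEvBasis.eq_zero_of_retract`, `IsCoevBasis.eq_zero_of_retract`). In the other direction, the
cohomology in `⟨S⟩` of the twisted object is read off from the truncation of `⨁ S[n j]`
(`leftTilt_of_isEvBasis`, `rightTilt_of_isCoevBasis`).
-/

namespace TwistTilt

/-! ### Vanishing of morphism spaces -/

section HomVanish

variable {D : Type*} [Category* D] [Preadditive D]

/-- All morphisms from `X` to `Y` are zero. -/
def HomVanish (X Y : D) : Prop := ∀ f : X ⟶ Y, f = 0

lemma HomVanish.of_iso {X X' Y Y' : D} (h : HomVanish X Y) (a : X ≅ X') (b : Y ≅ Y') :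
    HomVanish X' Y' := by
  intro f
  have := h (a.hom ≫ f ≫ b.inv)
  rw [← cancel_epi a.hom, ← cancel_mono b.inv, Category.assoc, this]
  simp

variable [HasShift D ℤ] [∀ n : ℤ, (shiftFunctor D n).Additive]

/-- The isomorphism `X[a][b] ≅ X[c]` for `a + b = c`. -/
noncomputable def shiftAddIso (X : D) (a b c : ℤ) (h : a + b = c) : X⟦a⟧⟦b⟧ ≅ X⟦c⟧ :=
  ((shiftFunctorAdd' D a b c h).app X).symm

/-- The isomorphism `X[0] ≅ X`. -/
noncomputable def shiftZeroIso (X : D) : X⟦(0 : ℤ)⟧ ≅ X := (shiftFunctorZero D ℤ).app X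

lemma homVanish_shift_iff (X Y : D) (a : ℤ) : HomVanish (X⟦a⟧) (Y⟦a⟧) ↔ HomVanish X Y := by
  constructor
  · intro h f
    exact (shiftFunctor D a).map_injective (by rw [h (f⟦a⟧'), Functor.map_zero])
  · intro h f
    obtain ⟨g, rfl⟩ := (shiftFunctor D a).map_surjective f
    rw [h g, Functor.map_zero]

lemma HomVanish.shift {X Y : D} {a b : ℤ} (h : HomVanish (X⟦a⟧) (Y⟦b⟧)) (c d : ℤ)
    (e : b + c = a + d) : HomVanish (X⟦c⟧) (Y⟦d⟧) :=
  ((homVanish_shift_iff _ _ (c - a)).2 h).of_iso (shiftAddIso X a (c - a) c (by lia))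
    (shiftAddIso Y b (c - a) d (by lia))

lemma HomVanish.shift_right {X Y : D} {b : ℤ} (h : HomVanish X (Y⟦b⟧)) (c d : ℤ)
    (e : b + c = d) : HomVanish (X⟦c⟧) (Y⟦d⟧) :=
  (h.of_iso (shiftZeroIso X).symm (Iso.refl _)).shift c d (by lia)

lemma HomVanish.shift_left {X Y : D} {a : ℤ} (h : HomVanish (X⟦a⟧) Y) (c d : ℤ)
    (e : c = a + d) : HomVanish (X⟦c⟧) (Y⟦d⟧) :=
  (h.of_iso (Iso.refl _) (shiftZeroIso Y).symm).shift c d (by lia)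

lemma HomVanish.shift_both {X Y : D} (h : HomVanish X Y) (c d : ℤ)
    (e : c = d) : HomVanish (X⟦c⟧) (Y⟦d⟧) := by
  subst e
  exact (homVanish_shift_iff _ _ _).2 h

lemma isZero_shift {X : D} (n : ℤ) (h : IsZero X) : IsZero (X⟦n⟧) :=
  (shiftFunctor D n).map_isZero h

lemma isZero_of_isZero_shift {X : D} (n : ℤ) (h : IsZero (X⟦n⟧)) : IsZero X := by
  rw [IsZero.iff_id_eq_zero] at h ⊢
  apply (shiftFunctor D n).map_injective
  rw [CategoryTheory.Functor.map_id, Functor.map_zero]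
  exact h

end HomVanish

/-! ### Exactness of distinguished triangles -/

section Triangles

variable {D : Type*} [Category* D] [Preadditive D] [HasZeroObject D] [HasShift D ℤ]
  [∀ n : ℤ, (shiftFunctor D n).Additive] [Pretriangulated D]
  {X Y Z : D} {f : X ⟶ Y} {g : Y ⟶ Z} {h : Z ⟶ X⟦(1 : ℤ)⟧} (hT : Triangle.mk f g h ∈ distTriang D)

include hT

lemma dist_comp₁₂ : f ≫ g = 0 := comp_distTriang_mor_zero₁₂ _ hT

lemma dist_comp₂₃ : g ≫ h = 0 := comp_distTriang_mor_zero₂₃ _ hT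

lemma dist_comp₃₁ : h ≫ f⟦(1 : ℤ)⟧' = 0 := comp_distTriang_mor_zero₃₁ _ hT

lemma exists_lift₁ {W : D} (u : W ⟶ Y) (hu : u ≫ g = 0) : ∃ v : W ⟶ X, v ≫ f = u := by
  obtain ⟨v, hv⟩ := Triangle.coyoneda_exact₂ _ hT u hu
  exact ⟨v, hv.symm⟩

lemma exists_lift₂ {W : D} (u : W ⟶ Z) (hu : u ≫ h = 0) : ∃ v : W ⟶ Y, v ≫ g = u := by
  obtain ⟨v, hv⟩ := Triangle.coyoneda_exact₃ _ hT u hu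
  exact ⟨v, hv.symm⟩

lemma exists_lift₃ {W : D} (u : W ⟶ X) (hu : u ≫ f = 0) :
    ∃ v : W⟦(1 : ℤ)⟧ ⟶ Z, v ≫ h = u⟦(1 : ℤ)⟧' := by
  obtain ⟨v, hv⟩ := Triangle.coyoneda_exact₁ _ hT (u⟦(1 : ℤ)⟧')
    (((shiftFunctor D (1 : ℤ)).map_comp u f).symm.trans
      ((congrArg _ hu).trans (Functor.map_zero _ _ _)))
  exact ⟨v, hv.symm⟩

lemma exists_desc₂ {W : D} (u : Y ⟶ W) (hu : f ≫ u = 0) : ∃ v : Z ⟶ W, g ≫ v = u := by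
  obtain ⟨v, hv⟩ := Triangle.yoneda_exact₂ _ hT u hu
  exact ⟨v, hv.symm⟩

lemma exists_desc₃ {W : D} (u : Z ⟶ W) (hu : g ≫ u = 0) :
    ∃ v : X⟦(1 : ℤ)⟧ ⟶ W, h ≫ v = u := by
  obtain ⟨v, hv⟩ := Triangle.yoneda_exact₃ _ hT u hu
  exact ⟨v, hv.symm⟩

lemma exists_desc₁ {W : D} (u : X ⟶ W) (hu : h ≫ u⟦(1 : ℤ)⟧' = 0) :
    ∃ v : Y ⟶ W, f ≫ v = u := by
  have key : ∃ v : Y⟦(1 : ℤ)⟧ ⟶ W⟦(1 : ℤ)⟧, u⟦(1 : ℤ)⟧' = (-f⟦(1 : ℤ)⟧') ≫ v :=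
    Triangle.yoneda_exact₃ _ (rot_of_distTriang _ hT) (u⟦(1 : ℤ)⟧') hu
  obtain ⟨v, hv⟩ := key
  obtain ⟨v, rfl⟩ := (shiftFunctor D (1 : ℤ)).map_surjective v
  refine ⟨-v, (shiftFunctor D (1 : ℤ)).map_injective ?_⟩
  rw [hv, Preadditive.neg_comp, Preadditive.comp_neg, Functor.map_neg, Functor.map_comp]

lemma homVanish_to_mid {W : D} (h₁ : HomVanish W X) (h₃ : HomVanish W Z) : HomVanish W Y := by
  intro u
  obtain ⟨v, hv⟩ := exists_lift₁ hT u (h₃ _)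
  rw [← hv, h₁ v, zero_comp]

lemma homVanish_from_mid {W : D} (h₁ : HomVanish X W) (h₃ : HomVanish Z W) : HomVanish Y W := by
  intro u
  obtain ⟨v, hv⟩ := exists_desc₂ hT u (h₁ _)
  rw [← hv, h₃ v, comp_zero]

lemma eq_zero_of_comp_right {W : D} (hW : HomVanish (X⟦(1 : ℤ)⟧) W) (u : Z ⟶ W) (hu : g ≫ u = 0) :
    u = 0 := by
  obtain ⟨v, hv⟩ := exists_desc₃ hT u hu
  rw [← hv, hW v, comp_zero]

lemma eq_zero_of_comp_left {W : D} (hW : HomVanish (W⟦(1 : ℤ)⟧) Z) (u : W ⟶ X) (hu : u ≫ f = 0) :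
    u = 0 := by
  apply (shiftFunctor D (1 : ℤ)).map_injective
  obtain ⟨v, hv⟩ := exists_lift₃ hT u hu
  rw [← hv, hW v, zero_comp, Functor.map_zero]

lemma dist_of_iso {X' Y' Z' : D} {f' : X' ⟶ Y'} {g' : Y' ⟶ Z'} {h' : Z' ⟶ X'⟦(1 : ℤ)⟧}
    (a : X' ≅ X) (b : Y' ≅ Y) (c : Z' ≅ Z) (hf : f' ≫ b.hom = a.hom ≫ f)
    (hg : g' ≫ c.hom = b.hom ≫ g) (hh : h' ≫ a.hom⟦(1 : ℤ)⟧' = c.hom ≫ h) :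
    Triangle.mk f' g' h' ∈ distTriang D :=
  isomorphic_distinguished _ hT _ (Triangle.isoMk _ _ a b c hf hg hh)

lemma isLE_of_dist (t : TStructure D) (n : ℤ) (h₁ : t.IsLE X n) (h₃ : t.IsLE Z n) : t.IsLE Y n :=
  t.isLE₂ _ hT n h₁ h₃

lemma isGE_of_dist (t : TStructure D) (n : ℤ) (h₁ : t.IsGE X n) (h₃ : t.IsGE Z n) : t.IsGE Y n :=
  t.isGE₂ _ hT n h₁ h₃

end Triangles

/-! ### Simple objects of the heart -/

section Heart

variable {D : Type*} [Category* D] [Preadditive D] [HasZeroObject D] [HasShift D ℤ]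
  [∀ n : ℤ, (shiftFunctor D n).Additive] [Pretriangulated D] (t : TStructure D)

lemma homVanish_of_isLE_of_isGE {X Y : D} (a b : ℤ) (hX : t.IsLE X a) (hY : t.IsGE Y b)
    (h : a < b) : HomVanish X Y := fun f ↦ t.zero f a b h

variable {t}

lemma IsSimpleInHeart.isLE {X : D} (h : IsSimpleInHeart t X) : t.IsLE X 0 := ⟨h.1.1⟩

lemma IsSimpleInHeart.isGE {X : D} (h : IsSimpleInHeart t X) : t.IsGE X 0 := ⟨h.1.2⟩

lemma IsSimpleInHeart.isLE_shift {X : D} (h : IsSimpleInHeart t X) (n m : ℤ)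
    (e : n + m = 0 := by lia) : t.IsLE (X⟦n⟧) m :=
  have := h.isLE
  t.isLE_shift X 0 n m e

lemma IsSimpleInHeart.isGE_shift {X : D} (h : IsSimpleInHeart t X) (n m : ℤ)
    (e : n + m = 0 := by lia) : t.IsGE (X⟦n⟧) m :=
  have := h.isGE
  t.isGE_shift X 0 n m e

lemma IsSimpleInHeart.not_isZero {X : D} (h : IsSimpleInHeart t X) : ¬ IsZero X := by
  obtain ⟨hX, hs⟩ := h
  intro h0
  have : (𝟙 (⟨X, hX⟩ : t.heart.FullSubcategory)) ≠ 0 :=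
    (Simple.mono_isIso_iff_nonzero _).1 inferInstance
  apply this
  ext
  exact h0.eq_of_src _ _

/-- A mono from an object of the heart to a simple object is zero or an isomorphism; here a mono
of the heart is recognized by testing on objects of the heart. -/
lemma IsSimpleInHeart.isIso_of_ne_zero {X K : D} (h : IsSimpleInHeart t X) (hK : t.heart K)
    (f : K ⟶ X) (hf : f ≠ 0)
    (hm : ∀ (Z : D) (_ : t.heart Z) (a : Z ⟶ K), a ≫ f = 0 → a = 0) : IsIso f := by
  obtain ⟨hX, hs⟩ := h
  let f' : (⟨K, hK⟩ : t.heart.FullSubcategory) ⟶ ⟨X, hX⟩ := ObjectProperty.homMk f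
  have : Mono f' := by
    refine Preadditive.mono_of_cancel_zero _ fun {Z} a ha ↦ ?_
    ext
    exact hm Z.obj Z.property a.hom congr(($ha).hom)
  have : IsIso f' := (Simple.mono_isIso_iff_nonzero f').2 fun h0 ↦ hf congr(($h0).hom)
  exact (inferInstance : IsIso (t.heart.ι.map f'))

section
variable [IsTriangulated D]

/-- Schur's lemma for the heart. -/
lemma IsSimpleInHeart.nonempty_iso {T S : D} (hT : IsSimpleInHeart t T)
    (hS : IsSimpleInHeart t S) (f : T ⟶ S) (hf : f ≠ 0) : Nonempty (T ≅ S) := by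
  have := hT.isLE
  have := hT.isGE
  have := hS.isLE
  have := hS.isGE
  obtain ⟨K, k, h, hK⟩ := distinguished_cocone_triangle₁ f
  have hS1 := hS.isGE_shift (-1) 1
  have : t.IsGE K 0 := t.isGE₂ _ (inv_rot_of_distTriang _ hK) 0
    (t.isGE_of_ge (S⟦(-1 : ℤ)⟧) 0 1) (inferInstanceAs (t.IsGE T 0))
  -- The kernel of `f` in the heart is the truncation of its fibre.
  let κ : (t.truncLE 0).obj K ⟶ T := (t.truncLEι 0).app K ≫ k
  have hκ : κ ≫ f = 0 := (Category.assoc _ _ _).trans (by rw [dist_comp₁₂ hK, comp_zero])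
  have hlift : ∀ (Z : D) (_ : t.heart Z) (a : Z ⟶ T), a ≫ f = 0 → ∃ b, a = b ≫ κ := by
    intro Z hZ a ha
    have : t.IsLE Z 0 := ⟨hZ.1⟩
    obtain ⟨b, hb⟩ := exists_lift₁ hK a ha
    exact ⟨t.liftTruncLE b 0, by rw [t.liftTruncLE_ι_assoc, hb]⟩
  have hκ0 : κ = 0 := by
    by_contra hne
    have : IsIso κ := by
      refine hT.isIso_of_ne_zero ⟨t.le_of_isLE _ _, t.ge_of_isGE _ _⟩ κ hne fun Z hZ a ha ↦ ?_
      have : t.IsLE Z 0 := ⟨hZ.1⟩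
      apply t.to_truncLE_obj_ext
      rw [zero_comp]
      refine eq_zero_of_comp_left hK ?_ _ ((Category.assoc _ _ _).trans ha)
      have : HomVanish Z (S⟦(-1 : ℤ)⟧) := homVanish_of_isLE_of_isGE t 0 1 ‹_› hS1 (by lia)
      exact (this.shift_right 1 0 (by lia)).of_iso (Iso.refl _) (shiftZeroIso S)
    exact hf (by rw [← cancel_epi κ, hκ, comp_zero])
  have : IsIso f := by
    refine hS.isIso_of_ne_zero hT.1 f hf fun Z hZ a ha ↦ ?_
    obtain ⟨b, rfl⟩ := hlift Z hZ a ha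
    rw [hκ0, comp_zero]
  exact ⟨asIso f⟩

end

lemma filtered_isLE {P : ObjectProperty D} {n : ℤ} (hP : ∀ X, P X → t.IsLE X n) {X : D}
    (hX : Filtered P X) : t.IsLE X n := by
  induction hX with
  | zero X hX => exact t.isLE_of_isZero hX n
  | step A E Q f g h hT _ hQ ih => exact t.isLE₂ _ hT n ih (hP _ hQ)

/-- A nonzero object of a finite length heart has a simple quotient. -/
lemma isZero_of_homVanish_to_simple {X : D} (hX : Filtered (IsSimpleInHeart t) X)
    (h : ∀ T, IsSimpleInHeart t T → HomVanish X T) : IsZero X := by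
  cases hX with
  | zero _ hX => exact hX
  | step A _ Q f g δ hT hA hQ =>
    -- If the last quotient map `X ⟶ Q` is zero, then `Q` is a direct summand of `A[1]`.
    have hg : g = 0 := h Q hQ g
    have hA' : t.IsLE A 0 := filtered_isLE (fun X hX ↦ hX.isLE) hA
    have := t.isLE_shift A 0 1 (-1)
    have hv : HomVanish (A⟦(1 : ℤ)⟧) Q :=
      fun r ↦ t.zero_of_isLE_of_isGE r (-1) 0 (by lia) this hQ.isGE
    have : 𝟙 Q = 0 := eq_zero_of_comp_right hT hv _ (by rw [hg, zero_comp])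
    exact (hQ.not_isZero ((IsZero.iff_id_eq_zero Q).2 this)).elim

/-- A nonzero object of a finite length heart has a simple subobject. -/
lemma isZero_of_homVanish_from_simple {X : D} (hX : Filtered (IsSimpleInHeart t) X)
    (h : ∀ T, IsSimpleInHeart t T → HomVanish T X) : IsZero X := by
  induction hX with
  | zero X hX => exact hX
  | step A E Q f g δ hT hA hQ ih =>
    have hA0 : IsZero A := ih fun T hT' u ↦
      eq_zero_of_comp_left hT (homVanish_of_isLE_of_isGE t (-1) 0
        (hT'.isLE_shift 1 (-1)) hQ.isGE (by lia)) u (h T hT' _)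
    have : IsIso g := (Triangle.isZero₁_iff_isIso₂ _ hT).1 hA0
    have hinv : inv g = 0 := h Q hQ (inv g)
    have : 𝟙 Q = 0 := by rw [← IsIso.inv_hom_id g, hinv, zero_comp]
    exact (hQ.not_isZero ((IsZero.iff_id_eq_zero Q).2 this)).elim

/-- In a finite length heart, the inequality `X ≤ 0` can be tested on simple objects. -/
lemma isLE_zero_of_homVanish_simple [IsTriangulated D] (hB : IsFiniteLengthHeart t) {X : D}
    (hX : t.bounded X)
    (h : ∀ T, IsSimpleInHeart t T → ∀ m : ℤ, m < 0 → HomVanish X (T⟦m⟧)) : t.IsLE X 0 := by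
  obtain ⟨N, hN⟩ := hX.2
  have key : ∀ n : ℕ, t.IsLE X n → t.IsLE X 0 := by
    intro n
    induction n with
    | zero => exact id
    | succ n ih =>
      intro hn
      apply ih
      rw [t.isLE_iff_isZero_truncGE_obj n (n + 1) rfl]
      let W := (t.truncGE (n + 1)).obj X
      have : t.IsLE X (n + 1) := by exact_mod_cast hn
      have h1 : t.IsLE W (n + 1) := inferInstance
      have h2 : t.IsGE W (n + 1) := inferInstance
      have h3 := t.isLE_shift W (n + 1) (n + 1) 0
      have h4 := t.isGE_shift W (n + 1) (n + 1) 0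
      have h5 : IsZero (W⟦(n + 1 : ℤ)⟧) := by
        refine isZero_of_homVanish_to_simple (hB _ ⟨h3.le, h4.ge⟩) fun T hT ↦ ?_
        have : HomVanish W (T⟦-(n + 1 : ℤ)⟧) := by
          intro u
          have := hT.isGE_shift (-(n + 1)) (n + 1)
          apply t.from_truncGE_obj_ext
          rw [comp_zero]
          exact h T hT _ (by lia) _
        exact (this.shift_right (n + 1) 0 (by lia)).of_iso (Iso.refl _) (shiftZeroIso T)
      rw [IsZero.iff_id_eq_zero] at h5 ⊢
      apply (shiftFunctor D (n + 1 : ℤ)).map_injective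
      rw [CategoryTheory.Functor.map_id, Functor.map_zero]
      exact h5
  exact key N.toNat (t.isLE_of_le X N _ (Int.self_le_toNat N))

/-- In a finite length heart, the inequality `X ≥ 0` can be tested on simple objects. -/
lemma isGE_zero_of_homVanish_simple [IsTriangulated D] (hB : IsFiniteLengthHeart t) {X : D}
    (hX : t.bounded X)
    (h : ∀ T, IsSimpleInHeart t T → ∀ m : ℤ, 0 < m → HomVanish (T⟦m⟧) X) : t.IsGE X 0 := by
  obtain ⟨N, hN⟩ := hX.1
  have key : ∀ n : ℕ, t.IsGE X (-n) → t.IsGE X 0 := by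
    intro n
    induction n with
    | zero => simp
    | succ n ih =>
      intro hn
      apply ih
      rw [t.isGE_iff_isZero_truncLE_obj (-(n + 1)) (-n) (by lia)]
      let W := (t.truncLE (-(n + 1))).obj X
      have : t.IsGE X (-(n + 1)) := by exact_mod_cast hn
      have h1 : t.IsLE W (-(n + 1)) := inferInstance
      have h2 : t.IsGE W (-(n + 1)) := inferInstance
      have h3 := t.isLE_shift W (-(n + 1)) (-(n + 1)) 0
      have h4 := t.isGE_shift W (-(n + 1)) (-(n + 1)) 0
      have h5 : IsZero (W⟦(-(n + 1) : ℤ)⟧) := by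
        refine isZero_of_homVanish_from_simple (hB _ ⟨h3.le, h4.ge⟩) fun T hT ↦ ?_
        have : HomVanish (T⟦(n + 1 : ℤ)⟧) W := by
          intro u
          have := hT.isLE_shift (n + 1) (-(n + 1))
          apply t.to_truncLE_obj_ext
          rw [zero_comp]
          exact h T hT _ (by lia) _
        exact (this.shift_left 0 (-(n + 1)) (by lia)).of_iso (shiftZeroIso T) (Iso.refl _)
      rw [IsZero.iff_id_eq_zero] at h5 ⊢
      apply (shiftFunctor D (-(n + 1) : ℤ)).map_injective
      rw [CategoryTheory.Functor.map_id, Functor.map_zero]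
      exact h5
  exact key (-N).toNat (t.isGE_of_ge X _ N (by have := Int.self_le_toNat (-N); lia))

end Heart

/-! ### Iterated self-extensions of `S` -/

section Generated

variable {D : Type*} [Category* D] [Preadditive D] [HasZeroObject D] [HasShift D ℤ]
  [∀ n : ℤ, (shiftFunctor D n).Additive] [Pretriangulated D]

lemma Filtered.of_iso {P : ObjectProperty D} {X Y : D} (hX : Filtered P X) (e : X ≅ Y) :
    Filtered P Y := by
  cases hX with
  | zero _ hX => exact .zero _ (hX.of_iso e.symm)
  | step A _ Q f g h hT hA hQ =>
    exact .step A Y Q (f ≫ e.hom) (e.inv ≫ g) h (dist_of_iso hT (Iso.refl _) e.symm (Iso.refl _)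
      (by simp) (by simp) (by simp)) hA hQ

variable {S : D}

lemma generatedBy_of_iso {X Y : D} (hX : generatedBy S X) (e : X ≅ Y) : generatedBy S Y :=
  Filtered.of_iso hX e

lemma generatedBy_biprod {X Q : D} (hX : generatedBy S X) (e : Q ≅ S) :
    generatedBy S (X ⊞ Q) :=
  .step _ _ _ _ _ _ (binaryBiproductTriangle_distinguished X Q) hX ⟨e⟩

lemma generatedBy_biproduct {J : Type*} [Fintype J] (X : J → D)
    (hX : ∀ j, IsZero (X j) ∨ Nonempty (X j ≅ S)) : generatedBy S (⨁ X) := by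
  classical
  -- The objects whose direct sums with objects of `⟨S⟩` stay in `⟨S⟩` are closed under sums.
  let P : ObjectProperty D := fun Y ↦ ∀ Z, generatedBy S Z → generatedBy S (Z ⊞ Y)
  have hiso : P.IsClosedUnderIsomorphisms :=
    ⟨fun e h Z hZ ↦ generatedBy_of_iso (h Z hZ) (biprod.mapIso (Iso.refl Z) e)⟩
  have hzero : ∀ Y, IsZero Y → P Y := fun Y hY Z hZ ↦
    generatedBy_of_iso hZ (isoBiprodZero hY)
  have : P.ContainsZero := ⟨_, isZero_zero D, hzero _ (isZero_zero D)⟩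
  have : P.IsClosedUnderBinaryProducts := by
    refine .mk' ?_
    rintro _ ⟨F, hF⟩
    have h := hF ⟨WalkingPair.left⟩
    have h' := hF ⟨WalkingPair.right⟩
    refine P.prop_of_iso ((biprod.isoProd _ _) ≪≫ (HasLimit.isoOfNatIso (diagramIsoPair F)).symm) ?_
    intro Z hZ
    exact generatedBy_of_iso (h' _ (h _ hZ)) (biprod.associator _ _ _)
  have : P.IsClosedUnderFiniteProducts := .mk'
  have hP : P (⨁ X) := by
    refine P.prop_of_isLimit_fan (biproduct.isLimit X) fun j ↦ ?_
    rcases hX j with h | ⟨⟨e⟩⟩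
    · exact hzero _ h
    · exact fun Z hZ ↦ generatedBy_biprod hZ e
  refine generatedBy_of_iso (hP _ (.zero _ (isZero_zero D))) ?_
  exact (isoZeroBiprod (isZero_zero D)).symm

/-- If `Ext¹(S, S) = 0`, each object `Y` of `⟨S⟩` is a direct summand of a finite direct sum
of copies of `S`: its identity is a sum of composites `Y ⟶ S ⟶ Y`. -/
lemma exists_id_eq_sum (hS : HomVanish S (S⟦(1 : ℤ)⟧)) {Y : D} (hY : generatedBy S Y) :
    ∃ (c : ℕ) (r : Fin c → (Y ⟶ S)) (s : Fin c → (S ⟶ Y)), 𝟙 Y = ∑ i, r i ≫ s i := by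
  induction hY with
  | zero Y hY => exact ⟨0, Fin.elim0, Fin.elim0, hY.eq_of_src _ _⟩
  | step A E Q f g h hT hA hQ ih =>
    obtain ⟨c, r, s, hrs⟩ := ih
    obtain ⟨e⟩ := hQ
    -- By induction `A` is a summand of a sum of copies of `S`, so that the extension splits.
    have hv : h = 0 := by
      rw [← cancel_epi e.inv, comp_zero, ← Category.comp_id (e.inv ≫ h),
        ← CategoryTheory.Functor.map_id, hrs, Functor.map_sum, Preadditive.comp_sum]
      refine Finset.sum_eq_zero fun i _ ↦ ?_
      rw [Functor.map_comp, ← Category.assoc, hS ((e.inv ≫ h) ≫ _), zero_comp]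
    obtain ⟨σ, hσ⟩ := exists_lift₂ hT (𝟙 Q) (by rw [hv, comp_zero])
    obtain ⟨τ, hτ⟩ := exists_lift₁ hT (𝟙 E - g ≫ σ) (by simp [hσ])
    refine ⟨c + 1, Fin.cons (g ≫ e.hom) fun i ↦ τ ≫ r i,
      Fin.cons (e.inv ≫ σ) fun i ↦ s i ≫ f, ?_⟩
    have h1 : τ ≫ f = ∑ i, (τ ≫ r i) ≫ s i ≫ f := by
      conv_lhs => rw [← Category.id_comp f, hrs]
      simp [Preadditive.sum_comp, Preadditive.comp_sum]
    rw [Fin.sum_univ_succ]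
    simp only [Fin.cons_zero, Fin.cons_succ]
    rw [← h1, hτ]
    simp

end Generated

/-! ### Description of the tilts by truncations -/

section Coh

variable {D : Type*} [Category* D] [Preadditive D] [HasZeroObject D] [HasShift D ℤ]
  [∀ n : ℤ, (shiftFunctor D n).Additive] [Pretriangulated D]
  (t : TStructure D)

/-- `τ≥n (τ≤n X) ≅ τ≥n X` if `X` is `≤ n`. -/
noncomputable def truncGELEIsoOfIsLE (n : ℤ) (X : D) [t.IsLE X n] :
    (t.truncGELE n n).obj X ≅ (t.truncGE n).obj X :=
  (t.truncGE n).mapIso (asIso ((t.truncLEι n).app X))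

/-- `τ≥n (τ≤n X) ≅ τ≤n X` if `X` is `≥ n`. -/
noncomputable def truncGELEIsoOfIsGE [IsTriangulated D] (n : ℤ) (X : D) [t.IsGE X n] :
    (t.truncGELE n n).obj X ≅ (t.truncLE n).obj X :=
  (asIso ((t.truncGEπ n).app ((t.truncLE n).obj X))).symm

lemma isLE_of_isZero_coh {X : D} (hX : t.bounded X) (b : ℤ)
    (h : ∀ i, b < i → IsZero (coh t i X)) : t.IsLE X b := by
  obtain ⟨N, hN⟩ := hX.2
  have key : ∀ n : ℕ, t.IsLE X (b + n) → t.IsLE X b := by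
    intro n
    induction n with
    | zero => simp
    | succ n ih =>
      intro hn
      apply ih
      rw [t.isLE_iff_isZero_truncGE_obj (b + n) (b + (n + 1 : ℕ)) (by push_cast; ring)]
      exact (isZero_of_isZero_shift _ (h (b + (n + 1 : ℕ)) (by lia))).of_iso
        (truncGELEIsoOfIsLE t _ X).symm
  exact key (N - b).toNat (t.isLE_of_le X N _ (by have := Int.self_le_toNat (N - b); lia))

lemma isGE_of_isZero_coh [IsTriangulated D] {X : D} (hX : t.bounded X) (a : ℤ)
    (h : ∀ i, i < a → IsZero (coh t i X)) : t.IsGE X a := by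
  obtain ⟨N, hN⟩ := hX.1
  have key : ∀ n : ℕ, t.IsGE X (a - n) → t.IsGE X a := by
    intro n
    induction n with
    | zero => simp
    | succ n ih =>
      intro hn
      apply ih
      rw [t.isGE_iff_isZero_truncLE_obj (a - (n + 1 : ℕ)) (a - n) (by push_cast; ring)]
      exact (isZero_of_isZero_shift _ (h (a - (n + 1 : ℕ)) (by lia))).of_iso
        (truncGELEIsoOfIsGE t _ X).symm
  exact key (a - N).toNat (t.isGE_of_ge X _ N (by have := Int.self_le_toNat (a - N); lia))

lemma isZero_coh_of_isLE {X : D} (i b : ℤ) [t.IsLE X b] (h : b < i) : IsZero (coh t i X) := by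
  have : t.IsLE X i := t.isLE_of_le X b i
  have hX : t.IsLE X (i - 1) := t.isLE_of_le X b (i - 1)
  exact isZero_shift _ (((t.isLE_iff_isZero_truncGE_obj (i - 1) i (by lia) X).1 hX).of_iso
    (truncGELEIsoOfIsLE t i X))

lemma isZero_coh_of_isGE [IsTriangulated D] {X : D} (i a : ℤ) [t.IsGE X a] (h : i < a) :
    IsZero (coh t i X) := by
  have : t.IsGE X i := t.isGE_of_ge X i a
  have hX : t.IsGE X (i + 1) := t.isGE_of_ge X (i + 1) a
  exact isZero_shift _ (((t.isGE_iff_isZero_truncLE_obj i (i + 1) (by lia) X).1 hX).of_iso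
    (truncGELEIsoOfIsGE t i X))

/-- A morphism from an object `≤ n` to `X` amounts to one to `τ≤n X`. -/
lemma homVanish_truncLE_iff (n : ℤ) (Z X : D) [t.IsLE Z n] :
    HomVanish Z ((t.truncLE n).obj X) ↔ HomVanish Z X := by
  constructor
  · intro h f
    rw [← t.liftTruncLE_ι f n, h (t.liftTruncLE f n), zero_comp]
  · intro h f
    apply t.to_truncLE_obj_ext
    rw [zero_comp]
    exact h _

lemma homVanish_truncGE_iff (n : ℤ) (X Z : D) [t.IsGE Z n] :
    HomVanish ((t.truncGE n).obj X) Z ↔ HomVanish X Z := by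
  constructor
  · intro h f
    rw [← t.π_descTruncGE f n, h (t.descTruncGE f n), comp_zero]
  · intro h f
    apply t.from_truncGE_obj_ext
    rw [comp_zero]
    exact h _

/-- Description of the left tilt by truncations. -/
lemma leftTilt_iff [IsTriangulated D] (ht : ∀ X : D, t.bounded X) {S : D} [t.IsLE S 0] (G : D) :
    leftTilt t S G ↔ t.IsGE G 0 ∧ t.IsLE G 1 ∧ HomVanish S G ∧
      generatedBy S (((t.truncGE 1).obj G)⟦(1 : ℤ)⟧) := by
  have key : t.IsGE G 0 → t.IsLE G 1 → (leftTilt t S G ↔ HomVanish S G ∧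
      generatedBy S (((t.truncGE 1).obj G)⟦(1 : ℤ)⟧)) := by
    intro h0 h1
    have e0 : coh t 0 G ≅ (t.truncLE 0).obj G := shiftZeroIso _ ≪≫ truncGELEIsoOfIsGE t 0 G
    have e1 : coh t 1 G ≅ ((t.truncGE 1).obj G)⟦(1 : ℤ)⟧ :=
      (shiftFunctor D (1 : ℤ)).mapIso (truncGELEIsoOfIsLE t 1 G)
    have hS : (∀ f : S ⟶ coh t 0 G, f = 0) ↔ HomVanish S G := by
      rw [← homVanish_truncLE_iff t 0 S G]
      exact ⟨fun h ↦ HomVanish.of_iso h (Iso.refl _) e0,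
        fun h ↦ HomVanish.of_iso h (Iso.refl _) e0.symm⟩
    have hg : generatedBy S (coh t 1 G) ↔ generatedBy S (((t.truncGE 1).obj G)⟦(1 : ℤ)⟧) :=
      ⟨fun h ↦ generatedBy_of_iso h e1, fun h ↦ generatedBy_of_iso h e1.symm⟩
    rw [leftTilt, hS, hg]
    refine and_iff_right fun i hi0 hi1 ↦ ?_
    rcases lt_or_ge i 0 with h | h
    · exact isZero_coh_of_isGE t i 0 h
    · exact isZero_coh_of_isLE t i 1 (by lia)
  constructor
  · intro h
    have h0 : t.IsGE G 0 := isGE_of_isZero_coh t (ht G) 0 fun i hi ↦ h.1 i (by lia) (by lia)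
    have h1 : t.IsLE G 1 := isLE_of_isZero_coh t (ht G) 1 fun i hi ↦ h.1 i (by lia) (by lia)
    exact ⟨h0, h1, (key h0 h1).1 h⟩
  · rintro ⟨h0, h1, h⟩
    exact (key h0 h1).2 h

/-- Description of the right tilt by truncations. -/
lemma rightTilt_iff [IsTriangulated D] (ht : ∀ X : D, t.bounded X) {S : D} [t.IsGE S 0] (F : D) :
    rightTilt t S F ↔ t.IsGE F (-1) ∧ t.IsLE F 0 ∧ HomVanish F S ∧
      generatedBy S (((t.truncLE (-1)).obj F)⟦(-1 : ℤ)⟧) := by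
  have key : t.IsGE F (-1) → t.IsLE F 0 → (rightTilt t S F ↔ HomVanish F S ∧
      generatedBy S (((t.truncLE (-1)).obj F)⟦(-1 : ℤ)⟧)) := by
    intro h0 h1
    have e0 : coh t 0 F ≅ (t.truncGE 0).obj F := shiftZeroIso _ ≪≫ truncGELEIsoOfIsLE t 0 F
    have e1 : coh t (-1) F ≅ ((t.truncLE (-1)).obj F)⟦(-1 : ℤ)⟧ :=
      (shiftFunctor D (-1 : ℤ)).mapIso (truncGELEIsoOfIsGE t (-1) F)
    have hS : (∀ f : coh t 0 F ⟶ S, f = 0) ↔ HomVanish F S := by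
      rw [← homVanish_truncGE_iff t 0 F S]
      exact ⟨fun h ↦ HomVanish.of_iso h e0 (Iso.refl _),
        fun h ↦ HomVanish.of_iso h e0.symm (Iso.refl _)⟩
    have hg : generatedBy S (coh t (-1) F) ↔
        generatedBy S (((t.truncLE (-1)).obj F)⟦(-1 : ℤ)⟧) :=
      ⟨fun h ↦ generatedBy_of_iso h e1, fun h ↦ generatedBy_of_iso h e1.symm⟩
    rw [rightTilt, hS, hg, and_comm (a := generatedBy S _)]
    refine and_iff_right fun i hi0 hi1 ↦ ?_
    rcases lt_or_ge i 0 with h | h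
    · exact isZero_coh_of_isGE t i (-1) (by lia)
    · exact isZero_coh_of_isLE t i 0 (by lia)
  constructor
  · intro h
    have h0 : t.IsGE F (-1) :=
      isGE_of_isZero_coh t (ht F) (-1) fun i hi ↦ h.1 i (by lia) (by lia)
    have h1 : t.IsLE F 0 := isLE_of_isZero_coh t (ht F) 0 fun i hi ↦ h.1 i (by lia) (by lia)
    exact ⟨h0, h1, (key h0 h1).1 h⟩
  · rintro ⟨h0, h1, h⟩
    exact (key h0 h1).2 h

end Coh

/-! ### Serre duality -/

section Serre

variable {k : Type*} [Field k] {D : Type*} [Category* D] [Preadditive D] [Linear k D]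
  [HasShift D ℤ]

/-- A family of linear forms on the spaces `Hom(X, X[2])` such that the pairings
`Hom(X, Y) × Hom(Y, X[2]) → k`, `(f, g) ↦ tr (f ≫ g)`, are perfect. -/
structure IsSerreTrace (tr : ∀ X : D, (X ⟶ X⟦(2 : ℤ)⟧) →ₗ[k] k) : Prop where
  left_eq_zero : ∀ {X Y : D} (f : X ⟶ Y), (∀ g : Y ⟶ X⟦(2 : ℤ)⟧, tr X (f ≫ g) = 0) → f = 0
  right_eq_zero : ∀ {X Y : D} (g : Y ⟶ X⟦(2 : ℤ)⟧), (∀ f : X ⟶ Y, tr X (f ≫ g) = 0) → g = 0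
  exists_left : ∀ {X Y : D} (φ : (Y ⟶ X⟦(2 : ℤ)⟧) →ₗ[k] k),
    ∃ f : X ⟶ Y, ∀ g, φ g = tr X (f ≫ g)
  exists_right : ∀ {X Y : D} (φ : (X ⟶ Y) →ₗ[k] k),
    ∃ g : Y ⟶ X⟦(2 : ℤ)⟧, ∀ f, φ f = tr X (f ≫ g)

/-- The Serre duality pairings come from the linear forms `tr` dual to the identities, by naturality
in the second variable. -/
lemma IsTwoCalabiYau.exists_isSerreTrace (hD : IsTwoCalabiYau k D) :
    ∃ tr : ∀ X : D, (X ⟶ X⟦(2 : ℤ)⟧) →ₗ[k] k, IsSerreTrace tr := by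
  have := hD.finite_hom
  obtain ⟨e, -, he⟩ := hD.serre_duality
  have htr : ∀ (X Y : D) (f : X ⟶ Y) (g : Y ⟶ X⟦(2 : ℤ)⟧),
      e X X (𝟙 X) (f ≫ g) = e X Y f g := fun X Y f g ↦ by
    rw [← he X X Y (𝟙 X) f g, Category.id_comp]
  have hright : ∀ {X Y : D} (g : Y ⟶ X⟦(2 : ℤ)⟧), (∀ f : X ⟶ Y, e X X (𝟙 X) (f ≫ g) = 0) →
      g = 0 := by
    intro X Y g hg
    refine (Module.forall_dual_apply_eq_zero_iff k g).1 fun φ ↦ ?_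
    obtain ⟨f, rfl⟩ := (e X Y).surjective φ
    rw [← htr, hg]
  refine ⟨fun X ↦ e X X (𝟙 X), ?_, hright, ?_, ?_⟩
  · intro X Y f hf
    apply (e X Y).injective
    ext g
    simpa [← htr] using hf g
  · intro X Y φ
    exact ⟨(e X Y).symm φ, fun g ↦ by rw [htr]; simp⟩
  · intro X Y φ
    let p : (Y ⟶ X⟦(2 : ℤ)⟧) →ₗ[k] Module.Dual k (X ⟶ Y) := LinearMap.flip (e X Y).toLinearMap
    have hp : Function.Injective p := by
      rw [← LinearMap.ker_eq_bot, LinearMap.ker_eq_bot']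
      intro g hg
      exact hright g fun f ↦ by rw [htr]; exact congr($hg f)
    have hd : Module.finrank k (Y ⟶ X⟦(2 : ℤ)⟧) = Module.finrank k (Module.Dual k (X ⟶ Y)) := by
      rw [Subspace.dual_finrank_eq, (e X Y).finrank_eq, Subspace.dual_finrank_eq]
    obtain ⟨g, hg⟩ := (LinearMap.injective_iff_surjective_of_finrank_eq_finrank hd).1 hp φ
    exact ⟨g, fun f ↦ by rw [htr, ← hg]; rfl⟩

lemma IsTwoCalabiYau.homVanish_iff (hD : IsTwoCalabiYau k D) (X Y : D) :
    HomVanish X Y ↔ HomVanish Y (X⟦(2 : ℤ)⟧) := by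
  obtain ⟨tr, h⟩ := hD.exists_isSerreTrace
  exact ⟨fun hv g ↦ h.right_eq_zero g fun f ↦ by rw [hv f, zero_comp, map_zero],
    fun hv f ↦ h.left_eq_zero f fun g ↦ by rw [hv g, comp_zero, map_zero]⟩

lemma homVanish_shift_iff_to_shift (hD : IsTwoCalabiYau k D) (S G : D) (m l : ℤ) (h : m + 1 = l) :
    HomVanish (S⟦m⟧) G ↔ HomVanish G (S⟦l⟧⟦(1 : ℤ)⟧) := by
  rw [hD.homVanish_iff]
  let i : S⟦m⟧⟦(2 : ℤ)⟧ ≅ S⟦l⟧⟦(1 : ℤ)⟧ :=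
    shiftAddIso S m 2 (m + 2) rfl ≪≫ (shiftAddIso S l 1 (m + 2) (by lia)).symm
  exact ⟨fun h ↦ h.of_iso (Iso.refl _) i, fun h ↦ h.of_iso (Iso.refl _) i.symm⟩

/-- If `End X = k`, a morphism `X ⟶ X[2]` of trace zero is zero. -/
lemma IsSerreTrace.eq_zero_of_trace {tr : ∀ X : D, (X ⟶ X⟦(2 : ℤ)⟧) →ₗ[k] k}
    (h : IsSerreTrace tr) {X : D} (hX : ∀ f : X ⟶ X, ∃ c : k, f = c • 𝟙 X)
    (w : X ⟶ X⟦(2 : ℤ)⟧) (hw : tr X w = 0) : w = 0 := by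
  refine h.right_eq_zero w fun f ↦ ?_
  obtain ⟨c, rfl⟩ := hX f
  rw [Linear.smul_comp, Category.id_comp, map_smul, hw, smul_zero]

end Serre

/-! ### Morphisms between shifts of a spherical object -/

section Spherical

variable {k : Type*} [Field k] {D : Type*} [Category* D] [Preadditive D] [Linear k D]
  [HasShift D ℤ] {S : D}

lemma IsSpherical.homVanish [∀ n : ℤ, (shiftFunctor D n).Additive] (hS : IsSpherical k S)
    (a b : ℤ) (h0 : b ≠ a) (h2 : b ≠ a + 2) :
    HomVanish (S⟦a⟧) (S⟦b⟧) :=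
  HomVanish.shift_right (b := b - a) (hS.eq_zero (b - a) (by lia) (by lia)) a b (by lia)

lemma IsSpherical.not_isZero (hS : IsSpherical k S) : ¬ IsZero S := by
  intro h
  have : Subsingleton (S ⟶ S⟦(0 : ℤ)⟧) := ⟨fun f g ↦ h.eq_of_src f g⟩
  have h1 := hS.finrank_zero
  rw [Module.finrank_zero_of_subsingleton] at h1
  exact zero_ne_one h1

lemma IsSpherical.id_shift_ne_zero [∀ n : ℤ, (shiftFunctor D n).Additive]
    (hS : IsSpherical k S) (a : ℤ) : 𝟙 (S⟦a⟧) ≠ 0 := fun h ↦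
  hS.not_isZero (isZero_of_isZero_shift a ((IsZero.iff_id_eq_zero _).2 h))

lemma IsSpherical.exists_smul_id [∀ n : ℤ, (shiftFunctor D n).Linear k]
    (hS : IsSpherical k S) (a : ℤ) (f : S⟦a⟧ ⟶ S⟦a⟧) : ∃ c : k, f = c • 𝟙 (S⟦a⟧) := by
  obtain ⟨g, rfl⟩ := (shiftFunctor D a).map_surjective f
  have hne : (shiftZeroIso S).inv ≠ 0 := fun h ↦ hS.not_isZero
    ((IsZero.iff_id_eq_zero S).2 (by rw [← (shiftZeroIso S).inv_hom_id, h, zero_comp]))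
  obtain ⟨c, hc⟩ := (finrank_eq_one_iff_of_nonzero' _ hne).1 hS.finrank_zero
    (g ≫ (shiftZeroIso S).inv)
  refine ⟨c, ?_⟩
  have : g = c • 𝟙 S := by
    rw [← cancel_mono (shiftZeroIso S).inv, ← hc, Linear.smul_comp, Category.id_comp]
  rw [this, Functor.map_smul, CategoryTheory.Functor.map_id]

lemma IsSpherical.exists_smul_id_shift [∀ n : ℤ, (shiftFunctor D n).Linear k]
    (hS : IsSpherical k S) (a b : ℤ) (f : S⟦a⟧⟦b⟧ ⟶ S⟦a⟧⟦b⟧) :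
    ∃ c : k, f = c • 𝟙 (S⟦a⟧⟦b⟧) := by
  obtain ⟨g, rfl⟩ := (shiftFunctor D b).map_surjective f
  obtain ⟨c, rfl⟩ := hS.exists_smul_id a g
  exact ⟨c, by rw [Functor.map_smul, CategoryTheory.Functor.map_id]⟩

end Spherical

/-! ### Bases of evaluation and of coevaluation -/

section Families

variable {D : Type*} [Category* D] [Preadditive D]
  [HasShift D ℤ] [HasFiniteBiproducts D]
  {J : Type} [Fintype J] {n : J → ℤ} {S : D}

/-- The direct sum of the shifts `S[n j]`. -/
noncomputable abbrev sumShift (S : D) (n : J → ℤ) : D := ⨁ fun j ↦ S⟦n j⟧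

/-- The morphism `g : X ⟶ ⨁ S[n j]` has no components outside the summands with `n j = m`. -/
def IsPureTo (m : ℤ) {X : D} (g : X ⟶ sumShift S n) : Prop :=
  ∀ j, n j ≠ m → g ≫ biproduct.π (fun j ↦ S⟦n j⟧) j = 0

/-- The morphism `h : ⨁ S[n j] ⟶ X` vanishes on the summands with `n j ≠ m`. -/
def IsPureFrom (m : ℤ) {X : D} (h : sumShift S n ⟶ X) : Prop :=
  ∀ j, n j ≠ m → biproduct.ι (fun j ↦ S⟦n j⟧) j ≫ h = 0

lemma comp_eq_sum {X Y : D} (g : X ⟶ sumShift S n) (h : sumShift S n ⟶ Y) :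
    g ≫ h = ∑ j, (g ≫ biproduct.π (fun j ↦ S⟦n j⟧) j) ≫ biproduct.ι (fun j ↦ S⟦n j⟧) j ≫ h := by
  conv_lhs => rw [← Category.id_comp h, ← biproduct.total]
  rw [Preadditive.sum_comp, Preadditive.comp_sum]
  exact Finset.sum_congr rfl fun j _ ↦ by simp only [Category.assoc]

lemma IsPureTo.comp_eq_zero {m m' : ℤ} (hm : m ≠ m') {X Y : D} {g : X ⟶ sumShift S n}
    {h : sumShift S n ⟶ Y} (hg : IsPureTo m g) (hh : IsPureFrom m' h) : g ≫ h = 0 := by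
  rw [comp_eq_sum]
  refine Finset.sum_eq_zero fun j _ ↦ ?_
  by_cases hj : n j = m
  · rw [hh j (by rw [hj]; exact hm), comp_zero]
  · rw [hg j hj, zero_comp]

lemma isPureTo_ι (j : J) : IsPureTo (n j) (biproduct.ι (fun j ↦ S⟦n j⟧) j) := fun j' hj' ↦
  biproduct.ι_π_ne _ (by rintro rfl; exact hj' rfl)

lemma isPureFrom_π (j : J) : IsPureFrom (n j) (biproduct.π (fun j ↦ S⟦n j⟧) j) := fun j' hj' ↦
  biproduct.ι_π_ne _ (by rintro rfl; exact hj' rfl)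

/-- The components `S[n j] ⟶ F` of `e` form, for each `m`, a basis of `Hom(S[m], F)`: each
morphism `S[m] ⟶ F` factors uniquely through the summands with `n j = m`. -/
def IsEvBasis {F : D} (e : sumShift S n ⟶ F) : Prop :=
  ∀ (m : ℤ) (f : S⟦m⟧ ⟶ F), ∃! g : S⟦m⟧ ⟶ sumShift S n, IsPureTo m g ∧ g ≫ e = f

/-- The components `G ⟶ S[n j][1]` of `δ` form, for each `m`, a basis of `Hom(G, S[m][1])`: each
morphism `G ⟶ S[m][1]` factors uniquely through the summands with `n j = m`. -/
def IsCoevBasis {G : D} (δ : G ⟶ (sumShift S n)⟦(1 : ℤ)⟧) : Prop :=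
  ∀ (m : ℤ) (f : G ⟶ S⟦m⟧⟦(1 : ℤ)⟧),
    ∃! h : sumShift S n ⟶ S⟦m⟧, IsPureFrom m h ∧ δ ≫ h⟦(1 : ℤ)⟧' = f

/-- The linear lifting of the morphisms `S[m] ⟶ F` through a basis. -/
noncomputable def IsEvBasis.lift (k : Type*) [Field k] [Linear k D] {F : D}
    {e : sumShift S n ⟶ F} (he : IsEvBasis e) (m : ℤ) :
    (S⟦m⟧ ⟶ F) →ₗ[k] (S⟦m⟧ ⟶ sumShift S n) where
  toFun f := (he m f).choose
  map_add' f f' := by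
    have h := (he m f).choose_spec.1
    have h' := (he m f').choose_spec.1
    refine ((he m (f + f')).choose_spec.2 _ ⟨fun j hj ↦ ?_, ?_⟩).symm
    · rw [Preadditive.add_comp, h.1 j hj, h'.1 j hj, add_zero]
    · rw [Preadditive.add_comp, h.2, h'.2]
  map_smul' c f := by
    have h := (he m f).choose_spec.1
    refine ((he m (c • f)).choose_spec.2 _ ⟨fun j hj ↦ ?_, ?_⟩).symm
    · rw [RingHom.id_apply, Linear.smul_comp, h.1 j hj, smul_zero]
    · rw [RingHom.id_apply, Linear.smul_comp, h.2]

lemma IsEvBasis.isPureTo_lift {k : Type*} [Field k] [Linear k D]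
    {F : D} {e : sumShift S n ⟶ F} (he : IsEvBasis e) {m : ℤ}
    (f : S⟦m⟧ ⟶ F) : IsPureTo m (he.lift k m f) := (he m f).choose_spec.1.1

@[simp]
lemma IsEvBasis.lift_comp {k : Type*} [Field k] [Linear k D]
    {F : D} {e : sumShift S n ⟶ F} (he : IsEvBasis e) {m : ℤ}
    (f : S⟦m⟧ ⟶ F) : he.lift k m f ≫ e = f := (he m f).choose_spec.1.2

lemma IsEvBasis.lift_eq {k : Type*} [Field k] [Linear k D]
    {F : D} {e : sumShift S n ⟶ F} (he : IsEvBasis e) {m : ℤ}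
    (g : S⟦m⟧ ⟶ sumShift S n) (hg : IsPureTo m g) : he.lift k m (g ≫ e) = g :=
  ((he m (g ≫ e)).choose_spec.2 g ⟨hg, rfl⟩).symm

lemma IsEvBasis.eq_of_comp_eq {F : D} {e : sumShift S n ⟶ F} (he : IsEvBasis e) {m : ℤ}
    {g g' : S⟦m⟧ ⟶ sumShift S n} (hg : IsPureTo m g) (hg' : IsPureTo m g')
    (h : g ≫ e = g' ≫ e) : g = g' :=
  (he m (g' ≫ e)).unique ⟨hg, h⟩ ⟨hg', rfl⟩

/-- The linear extension of the morphisms `G ⟶ S[m][1]` through a basis. -/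
noncomputable def IsCoevBasis.desc (k : Type*) [Field k] [Linear k D]
    [∀ n : ℤ, (shiftFunctor D n).Additive] [∀ n : ℤ, (shiftFunctor D n).Linear k] {G : D}
    {δ : G ⟶ (sumShift S n)⟦(1 : ℤ)⟧} (hδ : IsCoevBasis δ) (m : ℤ) :
    (G ⟶ S⟦m⟧⟦(1 : ℤ)⟧) →ₗ[k] (sumShift S n ⟶ S⟦m⟧) where
  toFun f := (hδ m f).choose
  map_add' f f' := by
    have h := (hδ m f).choose_spec.1
    have h' := (hδ m f').choose_spec.1
    refine ((hδ m (f + f')).choose_spec.2 _ ⟨fun j hj ↦ ?_, ?_⟩).symm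
    · rw [Preadditive.comp_add, h.1 j hj, h'.1 j hj, add_zero]
    · rw [Functor.map_add, Preadditive.comp_add, h.2, h'.2]
  map_smul' c f := by
    have h := (hδ m f).choose_spec.1
    refine ((hδ m (c • f)).choose_spec.2 _ ⟨fun j hj ↦ ?_, ?_⟩).symm
    · rw [RingHom.id_apply, Linear.comp_smul, h.1 j hj, smul_zero]
    · rw [RingHom.id_apply, Functor.map_smul, Linear.comp_smul, h.2]

lemma IsCoevBasis.eq_of_comp_eq {G : D} {δ : G ⟶ (sumShift S n)⟦(1 : ℤ)⟧} (hδ : IsCoevBasis δ)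
    {m : ℤ} {h h' : sumShift S n ⟶ S⟦m⟧} (hh : IsPureFrom m h) (hh' : IsPureFrom m h')
    (e : δ ≫ h⟦(1 : ℤ)⟧' = δ ≫ h'⟦(1 : ℤ)⟧') : h = h' :=
  (hδ m (δ ≫ h'⟦(1 : ℤ)⟧')).unique ⟨hh, e⟩ ⟨hh', rfl⟩

section
variable {k : Type*} [Field k] [Linear k D]
  [∀ n : ℤ, (shiftFunctor D n).Additive] [∀ n : ℤ, (shiftFunctor D n).Linear k]

lemma IsCoevBasis.isPureFrom_desc {G : D} {δ : G ⟶ (sumShift S n)⟦(1 : ℤ)⟧} (hδ : IsCoevBasis δ)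
    {m : ℤ} (f : G ⟶ S⟦m⟧⟦(1 : ℤ)⟧) : IsPureFrom m (hδ.desc k m f) := (hδ m f).choose_spec.1.1

@[simp]
lemma IsCoevBasis.comp_desc {G : D} {δ : G ⟶ (sumShift S n)⟦(1 : ℤ)⟧} (hδ : IsCoevBasis δ)
    {m : ℤ} (f : G ⟶ S⟦m⟧⟦(1 : ℤ)⟧) : δ ≫ (hδ.desc k m f)⟦(1 : ℤ)⟧' = f :=
  (hδ m f).choose_spec.1.2

lemma IsCoevBasis.desc_eq {G : D} {δ : G ⟶ (sumShift S n)⟦(1 : ℤ)⟧} (hδ : IsCoevBasis δ)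
    {m : ℤ} (h : sumShift S n ⟶ S⟦m⟧) (hh : IsPureFrom m h) :
    hδ.desc k m (δ ≫ h⟦(1 : ℤ)⟧') = h :=
  ((hδ m (δ ≫ h⟦(1 : ℤ)⟧')).choose_spec.2 h ⟨hh, rfl⟩).symm

end

lemma IsEvBasis.homVanish {F : D} {e : sumShift S n ⟶ F} (he : IsEvBasis e) {m : ℤ}
    (hm : ∀ j, n j ≠ m) : HomVanish (S⟦m⟧) F := by
  intro f
  obtain ⟨g, ⟨hg, rfl⟩, -⟩ := he m f
  rw [comp_eq_sum]
  exact Finset.sum_eq_zero fun j _ ↦ by rw [hg j (hm j), zero_comp]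

lemma IsCoevBasis.homVanish [∀ n : ℤ, (shiftFunctor D n).Additive] {G : D}
    {δ : G ⟶ (sumShift S n)⟦(1 : ℤ)⟧} (hδ : IsCoevBasis δ) {m : ℤ}
    (hm : ∀ j, n j ≠ m) : HomVanish G (S⟦m⟧⟦(1 : ℤ)⟧) := by
  intro f
  obtain ⟨h, ⟨hh, rfl⟩, -⟩ := hδ m f
  have : h = 0 := biproduct.hom_ext' _ _ fun j ↦ by rw [hh j (hm j), comp_zero]
  rw [this, Functor.map_zero, comp_zero]

lemma isEvBasis_of_eq_zero {F : D} {e : sumShift S n ⟶ F}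
    (hex : ∀ (m : ℤ) (f : S⟦m⟧ ⟶ F), ∃ g : S⟦m⟧ ⟶ sumShift S n, IsPureTo m g ∧ g ≫ e = f)
    (hinj : ∀ (m : ℤ) (g : S⟦m⟧ ⟶ sumShift S n), IsPureTo m g → g ≫ e = 0 → g = 0) :
    IsEvBasis e := by
  intro m f
  obtain ⟨g, hg, hgf⟩ := hex m f
  refine ⟨g, ⟨hg, hgf⟩, fun g' ⟨hg', hgf'⟩ ↦ sub_eq_zero.1 (hinj m _ (fun j hj ↦ ?_) ?_)⟩
  · rw [Preadditive.sub_comp, hg j hj, hg' j hj, sub_zero]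
  · rw [Preadditive.sub_comp, hgf, hgf', sub_self]

lemma isCoevBasis_of_eq_zero [∀ n : ℤ, (shiftFunctor D n).Additive] {G : D}
    {δ : G ⟶ (sumShift S n)⟦(1 : ℤ)⟧}
    (hex : ∀ (m : ℤ) (f : G ⟶ S⟦m⟧⟦(1 : ℤ)⟧), ∃ h : sumShift S n ⟶ S⟦m⟧,
      IsPureFrom m h ∧ δ ≫ h⟦(1 : ℤ)⟧' = f)
    (hinj : ∀ (m : ℤ) (h : sumShift S n ⟶ S⟦m⟧), IsPureFrom m h → δ ≫ h⟦(1 : ℤ)⟧' = 0 → h = 0) :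
    IsCoevBasis δ := by
  intro m f
  obtain ⟨h, hh, hhf⟩ := hex m f
  refine ⟨h, ⟨hh, hhf⟩, fun h' ⟨hh', hhf'⟩ ↦ sub_eq_zero.1 (hinj m _ (fun j hj ↦ ?_) ?_)⟩
  · rw [Preadditive.comp_sub, hh j hj, hh' j hj, sub_zero]
  · rw [Functor.map_sub, Preadditive.comp_sub, hhf, hhf', sub_self]

lemma IsEvBasis.not_homVanish {k : Type*} [Field k] [Linear k D]
    [∀ n : ℤ, (shiftFunctor D n).Additive] (hS : IsSpherical k S)
    {F : D} {e : sumShift S n ⟶ F} (he : IsEvBasis e) (j : J) : ¬ HomVanish (S⟦n j⟧) F := by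
  intro h
  have h0 : biproduct.ι (fun j ↦ S⟦n j⟧) j = 0 :=
    he.eq_of_comp_eq (isPureTo_ι j) (fun _ _ ↦ zero_comp) (by rw [h (_ ≫ e), zero_comp])
  exact hS.id_shift_ne_zero (n j)
    (by rw [← biproduct.ι_π_self (fun j ↦ S⟦n j⟧) j, h0, zero_comp])

lemma IsCoevBasis.not_homVanish {k : Type*} [Field k] [Linear k D]
    [∀ n : ℤ, (shiftFunctor D n).Additive] (hS : IsSpherical k S)
    {G : D} {δ : G ⟶ (sumShift S n)⟦(1 : ℤ)⟧} (hδ : IsCoevBasis δ) (j : J) :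
    ¬ HomVanish G (S⟦n j⟧⟦(1 : ℤ)⟧) := by
  intro h
  have h0 : biproduct.π (fun j ↦ S⟦n j⟧) j = 0 :=
    hδ.eq_of_comp_eq (isPureFrom_π j) (fun _ _ ↦ comp_zero)
      (by rw [h (δ ≫ _), Functor.map_zero, comp_zero])
  exact hS.id_shift_ne_zero (n j)
    (by rw [← biproduct.ι_π_self (fun j ↦ S⟦n j⟧) j, h0, comp_zero])

end Families

/-! ### Evaluation triangles are coevaluation triangles -/

section Duality

variable {k : Type*} [Field k] {D : Type*} [Category* D] [Preadditive D] [Linear k D]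
  [HasZeroObject D] [HasShift D ℤ] [∀ n : ℤ, (shiftFunctor D n).Additive]
  [∀ n : ℤ, (shiftFunctor D n).Linear k] [Pretriangulated D]
  {J : Type} [Fintype J] {n : J → ℤ} {S F G : D}
  {e : sumShift S n ⟶ F} {η : F ⟶ G} {δ : G ⟶ (sumShift S n)⟦(1 : ℤ)⟧}

/-- If `RHom(S, F) ⊗ S ⟶ F ⟶ G` is a twist triangle, its connecting morphism is the
coevaluation of `G`: indeed `Hom(F, S[m])` is dual to `Hom(S[m-2], F)`, hence is identified with
the space of morphisms to `S[m]` from the summands with `n j = m - 2`, and what remains of the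
morphisms from the direct sum to `S[m]` gives `Hom(G, S[m][1])`. -/
theorem IsEvBasis.isCoevBasis (hD : IsTwoCalabiYau k D) (hS : IsSpherical k S)
    (hT : Triangle.mk e η δ ∈ distTriang D) (he : IsEvBasis e) : IsCoevBasis δ := by
  obtain ⟨tr, htr⟩ := hD.exists_isSerreTrace
  refine isCoevBasis_of_eq_zero (fun m f ↦ ?_) (fun m h hh hδ ↦ ?_)
  all_goals
    obtain ⟨l, hl⟩ : ∃ l : ℤ, l + 2 = m := ⟨m - 2, by lia⟩
    let α : S⟦m⟧ ≅ S⟦l⟧⟦(2 : ℤ)⟧ := (shiftAddIso S l 2 m hl).symm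
  · have hη : η ≫ f = 0 := by
      let β : S⟦m⟧⟦(1 : ℤ)⟧ ≅ S⟦l + 1⟧⟦(2 : ℤ)⟧ :=
        shiftAddIso S m 1 (l + 3) (by lia) ≪≫ (shiftAddIso S (l + 1) 2 (l + 3) (by lia)).symm
      have : (η ≫ f) ≫ β.hom = 0 := htr.right_eq_zero _ fun x ↦ by
        rw [← he.lift_comp (k := k) x]
        simp only [Category.assoc]
        rw [← Category.assoc e η, dist_comp₁₂ hT, zero_comp, comp_zero, map_zero]
      rw [← cancel_mono β.hom, this, zero_comp]
    obtain ⟨h₀, hh₀⟩ := exists_desc₃ hT f hη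
    obtain ⟨h₀, rfl⟩ := (shiftFunctor D (1 : ℤ)).map_surjective h₀
    -- Correct `h₀` by a morphism from `F` in order to kill its components in degree two.
    obtain ⟨y, hy⟩ := htr.exists_right
      (tr _ ∘ₗ Linear.rightComp k _ (h₀ ≫ α.hom) ∘ₗ he.lift k l)
    refine ⟨h₀ - e ≫ y ≫ α.inv, fun j hj ↦ ?_, ?_⟩
    · by_cases hjl : n j = l
      · subst hjl
        have h1 := hy (biproduct.ι (fun j ↦ S⟦n j⟧) j ≫ e)
        simp only [LinearMap.comp_apply, Linear.rightComp_apply] at h1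
        rw [he.lift_eq _ (isPureTo_ι j), ← sub_eq_zero, ← map_sub] at h1
        have h2 := htr.eq_zero_of_trace (hS.exists_smul_id _) _ h1
        rw [← cancel_mono α.hom]
        simpa using h2
      · exact hS.homVanish (n j) m (Ne.symm hj) (by lia) _
    · have h3 : δ ≫ (e ≫ y ≫ α.inv)⟦(1 : ℤ)⟧' = 0 := by
        rw [Functor.map_comp, ← Category.assoc, dist_comp₃₁ hT, zero_comp]
      rw [Functor.map_sub, Preadditive.comp_sub, h3, sub_zero, hh₀]
  · obtain ⟨h', rfl⟩ := exists_desc₁ hT h hδ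
    have : h' ≫ α.hom = 0 := htr.right_eq_zero _ fun x ↦ by
      rw [← he.lift_comp (k := k) x, Category.assoc, ← Category.assoc e h',
        ← Category.assoc (he.lift k l x), (he.isPureTo_lift x).comp_eq_zero (by lia) hh,
        zero_comp, map_zero]
    rw [← cancel_mono α.hom, Category.assoc, this, comp_zero, zero_comp]

/-- If `F` is the cocone of a coevaluation morphism `δ`, the morphism to `F` is an evaluation
morphism: this is the statement dual to `IsEvBasis.isCoevBasis`. -/
theorem IsCoevBasis.isEvBasis (hD : IsTwoCalabiYau k D) (hS : IsSpherical k S)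
    (hT : Triangle.mk e η δ ∈ distTriang D) (hδ : IsCoevBasis δ) : IsEvBasis e := by
  obtain ⟨tr, htr⟩ := hD.exists_isSerreTrace
  refine isEvBasis_of_eq_zero (fun m f ↦ ?_) (fun m g hg hge ↦ ?_)
  all_goals
    obtain ⟨l, hl⟩ : ∃ l : ℤ, m + 2 = l := ⟨m + 2, rfl⟩
    let γ : S⟦l⟧⟦(1 : ℤ)⟧ ≅ S⟦m⟧⟦(1 : ℤ)⟧⟦(2 : ℤ)⟧ :=
      shiftAddIso S l 1 (m + 3) (by lia) ≪≫ (shiftAddIso S (m + 1) 2 (m + 3) (by lia)).symm ≪≫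
        (shiftFunctor D (2 : ℤ)).mapIso (shiftAddIso S m 1 (m + 1) rfl).symm
  · have hη : f ≫ η = 0 := htr.left_eq_zero _ fun y ↦ by
      let γ' : S⟦m + 1⟧⟦(1 : ℤ)⟧ ≅ S⟦m⟧⟦(2 : ℤ)⟧ :=
        shiftAddIso S (m + 1) 1 (m + 2) (by lia) ≪≫ (shiftAddIso S m 2 (m + 2) rfl).symm
      have h1 := hδ.comp_desc (k := k) (y ≫ γ'.inv)
      have h2 : η ≫ y = 0 := by
        rw [← cancel_mono γ'.inv, Category.assoc, ← h1, ← Category.assoc, dist_comp₂₃ hT,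
          zero_comp, zero_comp]
      rw [Category.assoc, h2, comp_zero, map_zero]
    obtain ⟨g₀, hg₀⟩ := exists_lift₁ hT f hη
    -- Correct `g₀` by a morphism to `G` in order to kill its components in degree two.
    obtain ⟨w, hw⟩ := htr.exists_left
      (tr _ ∘ₗ Linear.leftComp k _ (g₀⟦(1 : ℤ)⟧') ∘ₗ Linear.rightComp k _ γ.hom ∘ₗ
        (shiftFunctor D (1 : ℤ)).mapLinearMap k ∘ₗ hδ.desc k l ∘ₗ Linear.rightComp k _ γ.inv)
    obtain ⟨v, hv⟩ := (shiftFunctor D (1 : ℤ)).map_surjective (w ≫ δ)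
    refine ⟨g₀ - v, fun j hj ↦ ?_, ?_⟩
    · by_cases hjl : n j = l
      · subst hjl
        have h1 := hw (δ ≫ (biproduct.π (fun j ↦ S⟦n j⟧) j)⟦(1 : ℤ)⟧' ≫ γ.hom)
        simp only [LinearMap.comp_apply, Linear.rightComp_apply, Linear.leftComp_apply,
          Functor.coe_mapLinearMap, Category.assoc, Iso.hom_inv_id, Category.comp_id] at h1
        rw [hδ.desc_eq _ (isPureFrom_π j), ← Category.assoc w, ← hv, ← sub_eq_zero,
          ← map_sub] at h1
        have h2 := htr.eq_zero_of_trace (hS.exists_smul_id_shift _ _) _ h1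
        apply (shiftFunctor D (1 : ℤ)).map_injective
        rw [← cancel_mono γ.hom]
        simpa using h2
      · exact hS.homVanish m (n j) hj (by lia) _
    · have h3 : v ≫ e = 0 := by
        apply (shiftFunctor D (1 : ℤ)).map_injective
        rw [Functor.map_comp, hv, Category.assoc, dist_comp₃₁ hT, comp_zero, Functor.map_zero]
      rw [Preadditive.sub_comp, h3, sub_zero, hg₀]
  · obtain ⟨w, hw⟩ := exists_lift₃ hT g hge
    have hw0 : w = 0 := htr.left_eq_zero _ fun y ↦ by
      have h1 := hδ.comp_desc (k := k) (y ≫ γ.inv)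
      have h2 : w ≫ y = 0 := by
        rw [← cancel_mono γ.inv, Category.assoc, ← h1, ← Category.assoc, hw,
          ← Functor.map_comp, hg.comp_eq_zero (by lia) (hδ.isPureFrom_desc _), Functor.map_zero,
          zero_comp]
      rw [h2, map_zero]
    apply (shiftFunctor D (1 : ℤ)).map_injective
    rw [← hw, hw0, zero_comp, Functor.map_zero]

end Duality

/-! ### Existence of bases, and the universal property of evaluation -/

section Existence

variable {k : Type*} [Field k] {D : Type*} [Category* D] [Preadditive D] [Linear k D]
  [HasShift D ℤ] [∀ n : ℤ, (shiftFunctor D n).Linear k] [HasFiniteBiproducts D] {S : D}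

lemma exists_isEvBasis (hfin : ∀ X Y : D, Module.Finite k (X ⟶ Y)) (hS : IsSpherical k S)
    (F : D) (N : ℤ) (hN : ∀ m, m ∉ Finset.Icc (-N) N → HomVanish (S⟦m⟧) F) :
    ∃ (J : Type) (_ : Fintype J) (n : J → ℤ) (e : sumShift S n ⟶ F), IsEvBasis e := by
  classical
  let b := fun m : ℤ ↦ Module.finBasis k (S⟦m⟧ ⟶ F)
  let J := Σ i : Finset.Icc (-N) N, Fin (Module.finrank k (S⟦(i : ℤ)⟧ ⟶ F))
  let n : J → ℤ := fun j ↦ j.1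
  let e : sumShift S n ⟶ F := biproduct.desc fun j : J ↦ b j.1 j.2
  have he : ∀ j : J, biproduct.ι (fun j ↦ S⟦n j⟧) j ≫ e = b j.1 j.2 := fun j ↦
    biproduct.ι_desc _ _
  refine ⟨J, inferInstance, n, e, isEvBasis_of_eq_zero (fun m f ↦ ?_) (fun m g hg hge ↦ ?_)⟩
  · by_cases hm : m ∈ Finset.Icc (-N) N
    · let ι' : Fin (Module.finrank k (S⟦m⟧ ⟶ F)) → (S⟦m⟧ ⟶ sumShift S n) :=
        fun i ↦ biproduct.ι (fun j ↦ S⟦n j⟧) ⟨⟨m, hm⟩, i⟩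
      refine ⟨∑ i, (b m).repr f i • ι' i, fun j hj ↦ ?_, ?_⟩
      · rw [Preadditive.sum_comp]
        exact Finset.sum_eq_zero fun i _ ↦ by
          rw [Linear.smul_comp, isPureTo_ι (⟨⟨m, hm⟩, i⟩ : J) j hj, smul_zero]
      · conv_rhs => rw [← (b m).sum_repr f]
        rw [Preadditive.sum_comp]
        exact Finset.sum_congr rfl fun i _ ↦ by
          rw [Linear.smul_comp]
          exact congrArg _ (he ⟨⟨m, hm⟩, i⟩)
    · exact ⟨0, fun _ _ ↦ zero_comp, by rw [zero_comp, hN m hm f]⟩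
  · refine biproduct.hom_ext _ _ fun j ↦ ?_
    rw [zero_comp]
    by_cases hj : n j = m
    · obtain ⟨⟨m', hm⟩, i⟩ := j
      obtain rfl : m' = m := hj
      choose c hc using fun i : Fin (Module.finrank k (S⟦m'⟧ ⟶ F)) ↦ hS.exists_smul_id m'
        (g ≫ biproduct.π (fun j ↦ S⟦n j⟧) (⟨⟨m', hm⟩, i⟩ : J))
      have h0 : ∑ i, c i • b m' i = 0 := by
        rw [← hge, comp_eq_sum, Fintype.sum_sigma]
        symm
        rw [Fintype.sum_eq_single ⟨m', hm⟩]
        · refine Finset.sum_congr rfl fun i _ ↦ ?_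
          rw [hc, he, Linear.smul_comp, Category.id_comp]
        · intro x hx
          refine Finset.sum_eq_zero fun i _ ↦ ?_
          rw [hg ⟨x, i⟩ fun h ↦ hx (Subtype.ext h), zero_comp]
      have := Fintype.linearIndependent_iff.1 (b m').linearIndependent c h0 i
      rw [hc, this, zero_smul]
    · exact hg j hj

lemma exists_isCoevBasis [∀ n : ℤ, (shiftFunctor D n).Additive]
    (hfin : ∀ X Y : D, Module.Finite k (X ⟶ Y)) (hS : IsSpherical k S)
    (G : D) (N : ℤ) (hN : ∀ m, m ∉ Finset.Icc (-N) N → HomVanish G (S⟦m⟧⟦(1 : ℤ)⟧)) :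
    ∃ (J : Type) (_ : Fintype J) (n : J → ℤ) (δ : G ⟶ (sumShift S n)⟦(1 : ℤ)⟧),
      IsCoevBasis δ := by
  classical
  let b := fun m : ℤ ↦ Module.finBasis k (G ⟶ S⟦m⟧⟦(1 : ℤ)⟧)
  let J := Σ i : Finset.Icc (-N) N, Fin (Module.finrank k (G ⟶ S⟦(i : ℤ)⟧⟦(1 : ℤ)⟧))
  let n : J → ℤ := fun j ↦ j.1
  let δ : G ⟶ (sumShift S n)⟦(1 : ℤ)⟧ :=
    ∑ j : J, (show G ⟶ S⟦n j⟧⟦(1 : ℤ)⟧ from b j.1 j.2) ≫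
      (biproduct.ι (fun j ↦ S⟦n j⟧) j)⟦(1 : ℤ)⟧'
  have hδ : ∀ {X : D} (h : sumShift S n ⟶ X), δ ≫ h⟦(1 : ℤ)⟧' =
      ∑ j : J, (show G ⟶ S⟦n j⟧⟦(1 : ℤ)⟧ from b j.1 j.2) ≫
        (biproduct.ι (fun j ↦ S⟦n j⟧) j ≫ h)⟦(1 : ℤ)⟧' := fun h ↦ by
    rw [Preadditive.sum_comp]
    exact Finset.sum_congr rfl fun j _ ↦ by rw [Functor.map_comp, Category.assoc]
  refine ⟨J, inferInstance, n, δ, isCoevBasis_of_eq_zero (fun m f ↦ ?_) (fun m h hh hδh ↦ ?_)⟩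
  · by_cases hm : m ∈ Finset.Icc (-N) N
    · let π' : Fin (Module.finrank k (G ⟶ S⟦m⟧⟦(1 : ℤ)⟧)) → (sumShift S n ⟶ S⟦m⟧) :=
        fun i ↦ biproduct.π (fun j ↦ S⟦n j⟧) ⟨⟨m, hm⟩, i⟩
      have hπ : ∀ i, δ ≫ (π' i)⟦(1 : ℤ)⟧' = b m i := fun i ↦ by
        rw [hδ, Fintype.sum_eq_single ⟨⟨m, hm⟩, i⟩]
        · have h1 : biproduct.ι (fun j ↦ S⟦n j⟧) (⟨⟨m, hm⟩, i⟩ : J) ≫ π' i = 𝟙 _ :=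
            biproduct.ι_π_self _ _
          rw [h1, CategoryTheory.Functor.map_id]
          exact Category.comp_id _
        · intro j hj
          have h1 : biproduct.ι (fun j ↦ S⟦n j⟧) j ≫ π' i = 0 := biproduct.ι_π_ne _ hj
          rw [h1, Functor.map_zero, comp_zero]
      refine ⟨∑ i, (b m).repr f i • π' i, fun j hj ↦ ?_, ?_⟩
      · rw [Preadditive.comp_sum]
        refine Finset.sum_eq_zero fun i _ ↦ ?_
        have h1 : biproduct.ι (fun j ↦ S⟦n j⟧) j ≫ π' i = 0 :=
          biproduct.ι_π_ne _ (by rintro rfl; exact hj rfl)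
        rw [Linear.comp_smul, h1, smul_zero]
      · conv_rhs => rw [← (b m).sum_repr f]
        rw [Functor.map_sum, Preadditive.comp_sum]
        exact Finset.sum_congr rfl fun i _ ↦ by
          rw [Functor.map_smul, Linear.comp_smul, hπ]
    · exact ⟨0, fun _ _ ↦ comp_zero, by rw [Functor.map_zero, comp_zero, hN m hm f]⟩
  · refine biproduct.hom_ext' _ _ fun j ↦ ?_
    rw [comp_zero]
    by_cases hj : n j = m
    · obtain ⟨⟨m', hm⟩, i⟩ := j
      obtain rfl : m' = m := hj
      choose c hc using fun i : Fin (Module.finrank k (G ⟶ S⟦m'⟧⟦(1 : ℤ)⟧)) ↦ hS.exists_smul_id m'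
        (biproduct.ι (fun j ↦ S⟦n j⟧) (⟨⟨m', hm⟩, i⟩ : J) ≫ h)
      have h0 : ∑ i, c i • b m' i = 0 := by
        rw [← hδh, hδ, Fintype.sum_sigma]
        symm
        rw [Fintype.sum_eq_single ⟨m', hm⟩]
        · refine Finset.sum_congr rfl fun i _ ↦ ?_
          rw [hc, Functor.map_smul, Linear.comp_smul, CategoryTheory.Functor.map_id]
          exact congrArg _ (Category.comp_id _)
        · intro x hx
          refine Finset.sum_eq_zero fun i _ ↦ ?_
          rw [hh ⟨x, i⟩ fun h ↦ hx (Subtype.ext h), Functor.map_zero, comp_zero]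
      have := Fintype.linearIndependent_iff.1 (b m').linearIndependent c h0 i
      rw [hc, this, zero_smul]
    · exact hh j hj

/-- A morphism given by bases of the spaces `Hom(S[m], F)` is an evaluation morphism. -/
lemma IsEvBasis.isEvaluation (hS : IsSpherical k S) {J : Type} [Fintype J] {n : J → ℤ} {F : D}
    {e : sumShift S n ⟶ F} (he : IsEvBasis e) : IsEvaluation k S F (sumShift S n) e := by
  refine ⟨fun m ↦ he.lift k m, fun Y φ ↦ ?_, fun m f ↦ he.lift_comp f⟩
  have hφ : ∀ (m m' : ℤ) (u : S⟦m⟧ ⟶ S⟦m'⟧) (_ : m' ≠ m → u = 0) (x : S⟦m'⟧ ⟶ F),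
      u ≫ φ m' x = φ m (u ≫ x) := by
    intro m m' u hu x
    by_cases hm : m' = m
    · subst hm
      obtain ⟨c, rfl⟩ := hS.exists_smul_id m' u
      simp
    · rw [hu hm, zero_comp, zero_comp, map_zero]
  refine ⟨biproduct.desc fun j ↦ φ (n j) (biproduct.ι (fun j ↦ S⟦n j⟧) j ≫ e), fun m f ↦ ?_,
    fun p hp ↦ ?_⟩
  · conv_rhs => rw [← he.lift_comp (k := k) f, comp_eq_sum, map_sum]
    rw [comp_eq_sum]
    refine Finset.sum_congr rfl fun j _ ↦ ?_
    rw [biproduct.ι_desc, hφ m (n j) _ (he.isPureTo_lift f j)]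
  · refine biproduct.hom_ext' _ _ fun j ↦ ?_
    rw [biproduct.ι_desc, ← hp (n j), he.lift_eq _ (isPureTo_ι j)]

end Existence

/-! ### Uniqueness of the twist -/

section Uniqueness

variable {k : Type*} [Field k] {D : Type*} [Category* D] [Preadditive D] [Linear k D]
  [HasShift D ℤ]

/-- The evaluation morphism is unique up to a unique isomorphism of its source. -/
lemma IsEvaluation.exists_iso {S F P P' : D} {ev : P ⟶ F} {ev' : P' ⟶ F}
    (h : IsEvaluation k S F P ev) (h' : IsEvaluation k S F P' ev') :
    ∃ a : P ≅ P', a.hom ≫ ev' = ev := by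
  obtain ⟨ι, hι, hev⟩ := h
  obtain ⟨ι', hι', hev'⟩ := h'
  obtain ⟨p, hp, -⟩ := hι P' ι'
  obtain ⟨q, hq, -⟩ := hι' P ι
  refine ⟨⟨p, q, (hι P ι).unique (fun m f ↦ ?_) (fun m f ↦ Category.comp_id _),
    (hι' P' ι').unique (fun m f ↦ ?_) (fun m f ↦ Category.comp_id _)⟩, ?_⟩
  · rw [← Category.assoc, hp, hq]
  · rw [← Category.assoc, hq, hp]
  · refine (hι F fun m ↦ LinearMap.id).unique (fun m f ↦ ?_) (fun m f ↦ hev m f)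
    rw [← Category.assoc, hp]
    exact hev' m f

variable [HasZeroObject D] [∀ n : ℤ, (shiftFunctor D n).Additive] [Pretriangulated D]

lemma IsTwist.nonempty_iso {S F G G' : D} (h : IsTwist k S F G) (h' : IsTwist k S F G') :
    Nonempty (G ≅ G') := by
  obtain ⟨P, ev, η, δ, he, hT⟩ := h
  obtain ⟨P', ev', η', δ', he', hT'⟩ := h'
  obtain ⟨a, ha⟩ := he.exists_iso he'
  exact ⟨Triangle.π₃.mapIso (isoTriangleOfIso₁₂ _ _ hT hT' a (Iso.refl F)
    ((Category.comp_id _).trans ha.symm))⟩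

lemma IsTwist.of_iso {S F G G' : D} (h : IsTwist k S F G) (e : G ≅ G') : IsTwist k S F G' := by
  obtain ⟨P, ev, η, δ, he, hT⟩ := h
  exact ⟨P, ev, η ≫ e.hom, e.inv ≫ δ, he, dist_of_iso hT (Iso.refl _) (Iso.refl _) e.symm
    (by simp) (by simp) (by simp)⟩

/-- The evaluation morphism of a twist triangle can be replaced by any other model of it. -/
lemma IsTwist.exists_dist {S F G : D} (h : IsTwist k S F G) {P : D} {e : P ⟶ F}
    (he : IsEvaluation k S F P e) :
    ∃ (η : F ⟶ G) (δ : G ⟶ P⟦(1 : ℤ)⟧), Triangle.mk e η δ ∈ distTriang D := by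
  obtain ⟨P', e', η, δ, he', hT⟩ := h
  obtain ⟨a, ha⟩ := he.exists_iso he'
  refine ⟨η, δ ≫ a.inv⟦(1 : ℤ)⟧', dist_of_iso hT a (Iso.refl _) (Iso.refl _) ?_ ?_ ?_⟩
  · simpa using ha.symm
  · simp
  · simp [← Functor.map_comp]

end Uniqueness

/-! ### Bases for bounded objects, and the existence of the twist -/

section Bounded

variable {k : Type*} [Field k] {D : Type*} [Category* D] [Preadditive D] [Linear k D]
  [HasZeroObject D] [HasShift D ℤ] [∀ n : ℤ, (shiftFunctor D n).Additive]
  [∀ n : ℤ, (shiftFunctor D n).Linear k] [Pretriangulated D] {S : D} {t : TStructure D}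

lemma exists_isEvBasis_of_bounded (hD : IsTwoCalabiYau k D) (hS : IsSpherical k S)
    (hS0 : t.IsLE S 0) (hS1 : t.IsGE S 0) (F : D) (hF : t.bounded F) :
    ∃ (J : Type) (_ : Fintype J) (n : J → ℤ) (e : sumShift S n ⟶ F), IsEvBasis e := by
  obtain ⟨⟨a, ha⟩, ⟨b, hb⟩⟩ := hF
  refine exists_isEvBasis hD.finite_hom hS F (|a| + |b| + 2) fun m hm ↦ ?_
  have hm' : -a < m ∨ m < -b - 2 := by
    rw [Finset.mem_Icc] at hm
    grind
  rcases hm' with h | h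
  · exact homVanish_of_isLE_of_isGE t (-m) a (t.isLE_shift S 0 m (-m)) ha (by lia)
  · rw [hD.homVanish_iff]
    have := t.isGE_shift S 0 m (-m)
    exact homVanish_of_isLE_of_isGE t b (-m - 2) hb (t.isGE_shift _ (-m) 2 (-m - 2)) (by lia)

lemma exists_isCoevBasis_of_bounded (hD : IsTwoCalabiYau k D) (hS : IsSpherical k S)
    (hS0 : t.IsLE S 0) (hS1 : t.IsGE S 0) (G : D) (hG : t.bounded G) :
    ∃ (J : Type) (_ : Fintype J) (n : J → ℤ) (δ : G ⟶ (sumShift S n)⟦(1 : ℤ)⟧),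
      IsCoevBasis δ := by
  obtain ⟨⟨a, ha⟩, ⟨b, hb⟩⟩ := hG
  refine exists_isCoevBasis hD.finite_hom hS G (|a| + |b| + 2) fun m hm ↦ ?_
  have hm' : -a + 1 < m ∨ m < -b - 1 := by
    rw [Finset.mem_Icc] at hm
    grind
  rcases hm' with h | h
  · have h1 : HomVanish (S⟦m - 1⟧) G :=
      homVanish_of_isLE_of_isGE t (-(m - 1)) a (t.isLE_shift S 0 (m - 1) _) ha (by lia)
    exact ((hD.homVanish_iff _ _).1 h1).of_iso (Iso.refl _)
      (shiftAddIso S (m - 1) 2 (m + 1) (by lia) ≪≫ (shiftAddIso S m 1 (m + 1) rfl).symm)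
  · have := t.isGE_shift S 0 m (-m)
    exact homVanish_of_isLE_of_isGE t b (-m - 1) hb (t.isGE_shift _ (-m) 1 (-m - 1)) (by lia)

lemma exists_isTwist (hD : IsTwoCalabiYau k D) (hS : IsSpherical k S)
    (hS0 : t.IsLE S 0) (hS1 : t.IsGE S 0) (F : D) (hF : t.bounded F) :
    ∃ G, IsTwist k S F G := by
  obtain ⟨J, _, n, e, he⟩ := exists_isEvBasis_of_bounded hD hS hS0 hS1 F hF
  obtain ⟨G, η, δ, hT⟩ := distinguished_cocone_triangle e
  exact ⟨G, _, e, η, δ, he.isEvaluation hS, hT⟩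

end Bounded

/-! ### Direct summands of sums of shifts -/

section Retract

variable {D : Type*} [Category* D] [Preadditive D]
  [HasShift D ℤ] [HasFiniteBiproducts D]
  {J : Type} [Fintype J] {n : J → ℤ} {S : D}

/-- Let `W` be a direct summand of a sum of copies of `S[l]`, and `q : W ⟶ F` a morphism through
which all morphisms `S[l] ⟶ F` factor. Then `q` identifies `W` with the part of degree `l` of the
source of an evaluation morphism `e`; so if composition with `q` is injective on the morphisms
from `Z` to `W`, then composition with `e` is injective on those from `Z` to that part. -/
lemma IsEvBasis.eq_zero_of_retract {F : D} {e : sumShift S n ⟶ F} (he : IsEvBasis e) {l : ℤ}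
    {W : D} (q : W ⟶ F) {c : ℕ} (r : Fin c → (W ⟶ S⟦l⟧)) (s : Fin c → (S⟦l⟧ ⟶ W))
    (hrs : 𝟙 W = ∑ i, r i ≫ s i) (hfac : ∀ u : S⟦l⟧ ⟶ F, ∃ u', u' ≫ q = u) {Z : D}
    (hinj : ∀ x : Z ⟶ W, x ≫ q = 0 → x = 0) (v : Z ⟶ sumShift S n) (hv : IsPureTo l v)
    (hve : v ≫ e = 0) : v = 0 := by
  choose g hg hge using fun i ↦ (he l (s i ≫ q)).exists.imp fun _ h ↦ h
  have hρ : ∀ j, ∃ ρ : S⟦n j⟧ ⟶ W,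
      n j = l → ρ ≫ q = biproduct.ι (fun j ↦ S⟦n j⟧) j ≫ e := by
    intro j
    by_cases hj : n j = l
    · subst hj
      obtain ⟨ρ, hρ⟩ := hfac (biproduct.ι (fun j ↦ S⟦n j⟧) j ≫ e)
      exact ⟨ρ, fun _ ↦ hρ⟩
    · exact ⟨0, fun h ↦ (hj h).elim⟩
  choose ρ hρ using hρ
  let a : W ⟶ sumShift S n := ∑ i, r i ≫ g i
  have ha : a ≫ e = q := by
    rw [← Category.id_comp q, hrs, Preadditive.sum_comp, Preadditive.sum_comp]
    exact Finset.sum_congr rfl fun i _ ↦ by rw [Category.assoc, Category.assoc, hge]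
  have hρa : ∀ j, n j = l → ρ j ≫ a = biproduct.ι (fun j ↦ S⟦n j⟧) j := by
    intro j hj
    refine he.eq_of_comp_eq (fun j' hj' ↦ ?_) (isPureTo_ι j) (by rw [Category.assoc, ha, hρ j hj])
    rw [Category.assoc, Preadditive.sum_comp, Finset.sum_eq_zero, comp_zero]
    intro i _
    rw [Category.assoc, hg i j' (by rwa [← hj]), comp_zero]
  have hx : ∑ j, (v ≫ biproduct.π (fun j ↦ S⟦n j⟧) j) ≫ ρ j = 0 := by
    apply hinj
    rw [← hve, comp_eq_sum, Preadditive.sum_comp]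
    refine Finset.sum_congr rfl fun j _ ↦ ?_
    by_cases hj : n j = l
    · rw [Category.assoc, hρ j hj]
    · rw [hv j hj, zero_comp, zero_comp, zero_comp]
  rw [← Category.comp_id v, comp_eq_sum, ← zero_comp (f := a), ← hx, Preadditive.sum_comp]
  refine Finset.sum_congr rfl fun j _ ↦ ?_
  by_cases hj : n j = l
  · rw [Category.assoc _ (ρ j), hρa j hj, Category.comp_id]
  · rw [hv j hj, zero_comp, zero_comp, zero_comp]

/-- The statement dual to `IsEvBasis.eq_zero_of_retract`. -/
lemma IsCoevBasis.eq_zero_of_retract [∀ n : ℤ, (shiftFunctor D n).Additive] {G : D}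
    {δ : G ⟶ (sumShift S n)⟦(1 : ℤ)⟧}
    (hδ : IsCoevBasis δ) {l : ℤ} {W : D} (p : G ⟶ W) {c : ℕ}
    (r : Fin c → (W ⟶ S⟦l⟧⟦(1 : ℤ)⟧)) (s : Fin c → (S⟦l⟧⟦(1 : ℤ)⟧ ⟶ W))
    (hrs : 𝟙 W = ∑ i, r i ≫ s i) (hfac : ∀ u : G ⟶ S⟦l⟧⟦(1 : ℤ)⟧, ∃ u', p ≫ u' = u) {Z : D}
    (hinj : ∀ x : W ⟶ Z⟦(1 : ℤ)⟧, p ≫ x = 0 → x = 0) (v : sumShift S n ⟶ Z)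
    (hv : IsPureFrom l v) (hδv : δ ≫ v⟦(1 : ℤ)⟧' = 0) : v = 0 := by
  choose h hh hδh using fun i ↦ (hδ l (p ≫ r i)).exists.imp fun _ h ↦ h
  have hρ : ∀ j, ∃ ρ : W ⟶ S⟦n j⟧⟦(1 : ℤ)⟧,
      n j = l → p ≫ ρ = δ ≫ (biproduct.π (fun j ↦ S⟦n j⟧) j)⟦(1 : ℤ)⟧' := by
    intro j
    by_cases hj : n j = l
    · subst hj
      obtain ⟨ρ, hρ⟩ := hfac (δ ≫ (biproduct.π (fun j ↦ S⟦n j⟧) j)⟦(1 : ℤ)⟧')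
      exact ⟨ρ, fun _ ↦ hρ⟩
    · exact ⟨0, fun h ↦ (hj h).elim⟩
  choose ρ hρ using hρ
  let a : (sumShift S n)⟦(1 : ℤ)⟧ ⟶ W := ∑ i, (h i)⟦(1 : ℤ)⟧' ≫ s i
  have ha : δ ≫ a = p := by
    rw [← Category.comp_id p, hrs, Preadditive.comp_sum, Preadditive.comp_sum]
    exact Finset.sum_congr rfl fun i _ ↦ by rw [← Category.assoc, ← Category.assoc, hδh]
  have hρa : ∀ j, n j = l → a ≫ ρ j = (biproduct.π (fun j ↦ S⟦n j⟧) j)⟦(1 : ℤ)⟧' := by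
    intro j hj
    obtain ⟨w, hw⟩ := (shiftFunctor D (1 : ℤ)).map_surjective (a ≫ ρ j)
    rw [← hw]
    congr 1
    refine hδ.eq_of_comp_eq (fun j' hj' ↦ ?_) (isPureFrom_π j)
      (by rw [hw, ← Category.assoc, ha, hρ j hj])
    apply (shiftFunctor D (1 : ℤ)).map_injective
    rw [Functor.map_comp, hw, ← Category.assoc, Preadditive.comp_sum, Finset.sum_eq_zero,
      zero_comp, Functor.map_zero]
    intro i _
    rw [← Category.assoc, ← Functor.map_comp, hh i j' (by rwa [← hj]), Functor.map_zero, zero_comp]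
  have hsum : v⟦(1 : ℤ)⟧' = ∑ j, (biproduct.π (fun j ↦ S⟦n j⟧) j)⟦(1 : ℤ)⟧' ≫
      (biproduct.ι (fun j ↦ S⟦n j⟧) j ≫ v)⟦(1 : ℤ)⟧' := by
    conv_lhs => rw [← Category.id_comp v, comp_eq_sum, Functor.map_sum]
    exact Finset.sum_congr rfl fun j _ ↦ by rw [Category.id_comp, Functor.map_comp]
  have hx : ∑ j, ρ j ≫ (biproduct.ι (fun j ↦ S⟦n j⟧) j ≫ v)⟦(1 : ℤ)⟧' = 0 := by
    apply hinj
    rw [← hδv, hsum, Preadditive.comp_sum, Preadditive.comp_sum]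
    refine Finset.sum_congr rfl fun j _ ↦ ?_
    by_cases hj : n j = l
    · rw [← Category.assoc, hρ j hj, Category.assoc]
    · rw [hv j hj, Functor.map_zero, comp_zero, comp_zero, comp_zero, comp_zero]
  apply (shiftFunctor D (1 : ℤ)).map_injective
  rw [Functor.map_zero, hsum, ← comp_zero (f := a), ← hx, Preadditive.comp_sum]
  refine Finset.sum_congr rfl fun j _ ↦ ?_
  by_cases hj : n j = l
  · rw [← Category.assoc, hρa j hj]
  · rw [hv j hj, Functor.map_zero, comp_zero, comp_zero, comp_zero]

end Retract

/-! ### Twisting between the heart and its tilts -/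

section Tilting

variable {k : Type*} [Field k] {D : Type*} [Category* D] [Preadditive D] [Linear k D]
  [HasZeroObject D] [HasShift D ℤ] [∀ n : ℤ, (shiftFunctor D n).Additive]
  [Pretriangulated D] {t : TStructure D}
  {J : Type} [Fintype J] {n : J → ℤ} {S F G : D}
  {e : sumShift S n ⟶ F} {η : F ⟶ G} {δ : G ⟶ (sumShift S n)⟦(1 : ℤ)⟧}

lemma homVanish_to_sumShift {X : D} (h : ∀ j, HomVanish X (S⟦n j⟧)) :
    HomVanish X (sumShift S n) := fun f ↦ biproduct.hom_ext _ _ fun j ↦ by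
  rw [zero_comp]
  exact h j _

lemma homVanish_from_sumShift {X : D} (h : ∀ j, HomVanish (S⟦n j⟧) X) :
    HomVanish (sumShift S n) X := fun f ↦ biproduct.hom_ext' _ _ fun j ↦ by
  rw [comp_zero]
  exact h j _

lemma isLE_sumShift (hS : t.IsLE S 0) (a : ℤ) (h : ∀ j, -n j ≤ a) :
    t.IsLE (sumShift S n) a := by
  rw [t.isLE_iff_orthogonal a (a + 1) rfl]
  intro Y f hY
  exact homVanish_from_sumShift (fun j ↦ homVanish_of_isLE_of_isGE t (-n j) (a + 1)
    (t.isLE_shift S 0 (n j) _) hY (by linarith [h j])) f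

lemma isGE_sumShift (hS : t.IsGE S 0) (a : ℤ) (h : ∀ j, a ≤ -n j) :
    t.IsGE (sumShift S n) a := by
  rw [t.isGE_iff_orthogonal (a - 1) a (by lia)]
  intro Y f hY
  exact homVanish_to_sumShift (fun j ↦ homVanish_of_isLE_of_isGE t (a - 1) (-n j) hY
    (t.isGE_shift S 0 (n j) _) (by linarith [h j])) f

lemma generatedBy_map_sumShift (Φ : D ⥤ D) [Φ.Additive]
    (h : ∀ j, IsZero (Φ.obj (S⟦n j⟧)) ∨ Nonempty (Φ.obj (S⟦n j⟧) ≅ S)) :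
    generatedBy S (Φ.obj (sumShift S n)) :=
  generatedBy_of_iso (generatedBy_biproduct (fun j ↦ Φ.obj (S⟦n j⟧)) h)
    (Φ.mapBiproduct fun j ↦ S⟦n j⟧).symm

/-- Between shifts of nonisomorphic simple objects, the nonzero morphisms have positive degree. -/
lemma IsSimpleInHeart.homVanish_shift [IsTriangulated D] {S T : D} (hS : IsSimpleInHeart t S)
    (hT : IsSimpleInHeart t T) (hne : ¬ Nonempty (S ≅ T)) (a b : ℤ) (h : b ≤ a) :
    HomVanish (S⟦a⟧) (T⟦b⟧) := by
  rcases h.eq_or_lt with rfl | h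
  · refine HomVanish.shift_both (fun f ↦ ?_) _ _ rfl
    by_contra hf
    exact hne (hS.nonempty_iso hT f hf)
  · exact homVanish_of_isLE_of_isGE t (-a) (-b) (hS.isLE_shift a _) (hT.isGE_shift b _) (by lia)

lemma exists_id_eq_sum_of_shift (hS : HomVanish S (S⟦(1 : ℤ)⟧)) {W X : D} (a : ℤ)
    (hW : generatedBy S (W⟦a⟧)) (i : X⟦a⟧ ≅ S) :
    ∃ (c : ℕ) (r : Fin c → (W ⟶ X)) (s : Fin c → (X ⟶ W)), 𝟙 W = ∑ i, r i ≫ s i := by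
  obtain ⟨c, r, s, hrs⟩ := exists_id_eq_sum hS hW
  choose r' hr' using fun j ↦ (shiftFunctor D a).map_surjective (r j ≫ i.inv)
  choose s' hs' using fun j ↦ (shiftFunctor D a).map_surjective (i.hom ≫ s j)
  refine ⟨c, r', s', (shiftFunctor D a).map_injective ?_⟩
  rw [CategoryTheory.Functor.map_id, hrs, Functor.map_sum]
  exact Finset.sum_congr rfl fun j _ ↦ by rw [Functor.map_comp, hr', hs']; simp

lemma IsCoevBasis.homVanish_from (hD : IsTwoCalabiYau k D) (hδ : IsCoevBasis δ) (m : ℤ)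
    (h : ∀ j, n j ≠ m + 1) : HomVanish (S⟦m⟧) G :=
  (homVanish_shift_iff_to_shift hD S G m (m + 1) rfl).2 (hδ.homVanish h)

lemma IsEvBasis.homVanish_to (hD : IsTwoCalabiYau k D) (he : IsEvBasis e) (m : ℤ)
    (h : ∀ j, n j ≠ m - 2) : HomVanish F (S⟦m⟧) :=
  ((hD.homVanish_iff _ _).1 (he.homVanish h)).of_iso (Iso.refl _)
    (shiftAddIso S (m - 2) 2 m (by lia))

variable [∀ n : ℤ, (shiftFunctor D n).Linear k] [IsTriangulated D]

/-- The twist of an object of the heart lies in the left tilt. -/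
theorem leftTilt_of_isEvBasis (hD : IsTwoCalabiYau k D) (ht : ∀ X : D, t.bounded X)
    (hB : IsFiniteLengthHeart t) (hS : IsSimpleInHeart t S) (hsph : IsSpherical k S)
    (hT : Triangle.mk e η δ ∈ distTriang D) (he : IsEvBasis e) (hF : t.heart F) :
    leftTilt t S G := by
  have hδ := he.isCoevBasis hD hsph hT
  have hF0 : t.IsLE F 0 := ⟨hF.1⟩
  have hF1 : t.IsGE F 0 := ⟨hF.2⟩
  have hS0 := hS.isLE
  have hS1 := hS.isGE
  have hT' : Triangle.mk η δ (-e⟦(1 : ℤ)⟧') ∈ distTriang D := rot_of_distTriang _ hT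
  have hn : ∀ j, -2 ≤ n j ∧ n j ≤ 0 := by
    intro j
    have h := he.not_homVanish hsph j
    contrapose! h
    by_cases hj : -2 ≤ n j
    · exact homVanish_of_isLE_of_isGE t (-n j) 0 (hS.isLE_shift _ _) hF1 (by have := h hj; lia)
    · have := hS.isGE_shift (n j) (-n j)
      exact (hD.homVanish_iff _ _).2 (homVanish_of_isLE_of_isGE t 0 (-n j - 2) hF0
        (t.isGE_shift _ (-n j) 2 _) (by lia))
  have hSG : ∀ m : ℤ, 0 ≤ m → HomVanish (S⟦m⟧) G := fun m hm ↦
    hδ.homVanish_from hD m fun j ↦ by have := hn j; lia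
  have hP : t.IsLE (sumShift S n) 2 := isLE_sumShift hS0 2 fun j ↦ by have := hn j; lia
  rw [leftTilt_iff t ht]
  refine ⟨?_, ?_, ?_, ?_⟩
  · refine isGE_zero_of_homVanish_simple hB (ht G) fun T hTs m hm ↦ ?_
    by_cases hne : Nonempty (T ≅ S)
    · obtain ⟨i⟩ := hne
      exact (hSG m hm.le).of_iso ((shiftFunctor D m).mapIso i.symm) (Iso.refl _)
    · refine homVanish_to_mid hT' (homVanish_of_isLE_of_isGE t (-m) 0
        (hTs.isLE_shift _ _) hF1 (by lia)) ?_
      refine HomVanish.shift_left (a := m - 1) ?_ m 1 (by lia)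
      exact homVanish_to_sumShift fun j ↦ hTs.homVanish_shift hS hne _ _
        (by have := hn j; lia)
  · exact isLE_of_dist hT' t 1 (t.isLE_of_le F 0 1) (t.isLE_shift _ 2 1 1)
  · exact (hSG 0 le_rfl).of_iso (shiftZeroIso S) (Iso.refl _)
  · -- As `F ≤ 0`, the truncation `τ≥1 G` is that of `(⨁ S[n j])[1]`, where only the summands
    -- with `n j = -2` contribute.
    have : IsIso ((t.truncGE 1).map δ) := t.isIso₂_truncGE_map_of_isLE _ hT' 0 1 rfl hF0
    refine generatedBy_of_iso (generatedBy_map_sumShift (n := n)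
      (shiftFunctor D (1 : ℤ) ⋙ t.truncGE 1 ⋙ shiftFunctor D (1 : ℤ)) fun j ↦ ?_)
      ((shiftFunctor D (1 : ℤ)).mapIso (asIso ((t.truncGE 1).map δ)).symm)
    by_cases hj : n j = -2
    · right
      have := hS.isGE_shift (n j) 2
      have := t.isGE_shift (S⟦n j⟧) 2 1 1
      exact ⟨(shiftFunctor D (1 : ℤ)).mapIso
        ((asIso ((t.truncGEπ 1).app (S⟦n j⟧⟦(1 : ℤ)⟧))).symm ≪≫
          shiftAddIso S (n j) 1 (-1) (by lia)) ≪≫ shiftAddIso S (-1) 1 0 (by lia) ≪≫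
          shiftZeroIso S⟩
    · left
      have := hS.isLE_shift (n j) (-n j)
      have : t.IsLE (S⟦n j⟧) 1 := t.isLE_of_le _ (-n j) 1 (by have := hn j; lia)
      have := t.isLE_shift (S⟦n j⟧) 1 1 0
      exact isZero_shift _ (t.isZero_truncGE_obj_of_isLE 0 1 rfl _)

/-- The inverse twist of an object of the heart lies in the right tilt. -/
theorem rightTilt_of_isCoevBasis (hD : IsTwoCalabiYau k D) (ht : ∀ X : D, t.bounded X)
    (hB : IsFiniteLengthHeart t) (hS : IsSimpleInHeart t S) (hsph : IsSpherical k S)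
    (hT : Triangle.mk e η δ ∈ distTriang D) (hδ : IsCoevBasis δ) (hG : t.heart G) :
    rightTilt t S F := by
  have he := hδ.isEvBasis hD hsph hT
  have hG0 : t.IsLE G 0 := ⟨hG.1⟩
  have hG1 : t.IsGE G 0 := ⟨hG.2⟩
  have hS0 := hS.isLE
  have hS1 := hS.isGE
  have hn : ∀ j, -1 ≤ n j ∧ n j ≤ 1 := by
    intro j
    have h := hδ.not_homVanish hsph j
    contrapose! h
    by_cases hj : -1 ≤ n j
    · exact (homVanish_shift_iff_to_shift hD S G (n j - 1) (n j) (by lia)).1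
        (homVanish_of_isLE_of_isGE t (-(n j - 1)) 0 (hS.isLE_shift _ _) hG1
          (by have := h hj; lia))
    · have := hS.isGE_shift (n j) (-n j)
      exact homVanish_of_isLE_of_isGE t 0 (-n j - 1) hG0 (t.isGE_shift _ (-n j) 1 _) (by lia)
  have hFS : ∀ m : ℤ, m ≤ 0 → HomVanish F (S⟦m⟧) := fun m hm ↦
    he.homVanish_to hD m fun j ↦ by have := hn j; lia
  rw [rightTilt_iff t ht]
  refine ⟨?_, ?_, ?_, ?_⟩
  · exact isGE_of_dist hT t (-1) (isGE_sumShift hS1 _ fun j ↦ by have := hn j; lia)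
      (t.isGE_of_ge G (-1) 0)
  · refine isLE_zero_of_homVanish_simple hB (ht F) fun T hTs m hm ↦ ?_
    by_cases hne : Nonempty (S ≅ T)
    · obtain ⟨i⟩ := hne
      exact (hFS m hm.le).of_iso (Iso.refl _) ((shiftFunctor D m).mapIso i)
    · exact homVanish_from_mid hT (homVanish_from_sumShift fun j ↦
        hS.homVanish_shift hTs hne _ _ (by have := hn j; lia))
        (homVanish_of_isLE_of_isGE t 0 (-m) hG0 (hTs.isGE_shift _ _) (by lia))
  · exact (hFS 0 le_rfl).of_iso (Iso.refl _) (shiftZeroIso S)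
  · -- As `G ≥ 0`, the truncation `τ≤-1 F` is that of `⨁ S[n j]`, where only the summands
    -- with `n j = 1` contribute.
    have : IsIso ((t.truncLE (-1)).map e) :=
      t.isIso₁_truncLE_map_of_isGE _ hT (-1) 0 (by lia) hG1
    refine generatedBy_of_iso (generatedBy_map_sumShift (n := n)
      (t.truncLE (-1) ⋙ shiftFunctor D (-1 : ℤ)) fun j ↦ ?_)
      ((shiftFunctor D (-1 : ℤ)).mapIso (asIso ((t.truncLE (-1)).map e)))
    by_cases hj : n j = 1
    · right
      have := hS.isLE_shift (n j) (-1)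
      exact ⟨(shiftFunctor D (-1 : ℤ)).mapIso (asIso ((t.truncLEι (-1)).app (S⟦n j⟧))) ≪≫
        shiftAddIso S (n j) (-1) 0 (by lia) ≪≫ shiftZeroIso S⟩
    · left
      have := hS.isGE_shift (n j) (-n j)
      have : t.IsGE (S⟦n j⟧) 0 := t.isGE_of_ge _ 0 (-n j) (by have := hn j; lia)
      exact isZero_shift _ (t.isZero_truncLE_obj_of_isGE (-1) 0 (by lia) _)

/-- The inverse twist of an object of the left tilt lies in the heart. -/
theorem heart_of_leftTilt (hD : IsTwoCalabiYau k D) (ht : ∀ X : D, t.bounded X)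
    (hB : IsFiniteLengthHeart t) (hS : IsSimpleInHeart t S) (hsph : IsSpherical k S)
    (hT : Triangle.mk e η δ ∈ distTriang D) (hδ : IsCoevBasis δ) (hG : leftTilt t S G) :
    t.heart F := by
  have he := hδ.isEvBasis hD hsph hT
  have hS0 := hS.isLE
  have hS1 := hS.isGE
  obtain ⟨hG0, hG1, hSG, hY⟩ := (leftTilt_iff t ht G).1 hG
  have hn : ∀ j, -2 ≤ n j ∧ n j ≤ 0 := by
    intro j
    have h := hδ.not_homVanish hsph j
    contrapose! h
    by_cases hj : -2 ≤ n j
    · refine (homVanish_shift_iff_to_shift hD S G (n j - 1) (n j) (by lia)).1 ?_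
      by_cases hj1 : n j - 1 = 0
      · rw [hj1]
        exact hSG.of_iso (shiftZeroIso S).symm (Iso.refl _)
      · exact homVanish_of_isLE_of_isGE t (-(n j - 1)) 0 (hS.isLE_shift _ _) hG0
          (by have := h hj; lia)
    · have := hS.isGE_shift (n j) (-n j)
      exact homVanish_of_isLE_of_isGE t 1 (-n j - 1) hG1 (t.isGE_shift _ (-n j) 1 _) (by lia)
  obtain ⟨c, r, s, hrs⟩ := exists_id_eq_sum_of_shift (X := S⟦(-2 : ℤ)⟧⟦(1 : ℤ)⟧)
    (hsph.eq_zero 1 (by lia) (by lia)) 1 hY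
    (shiftAddIso _ 1 1 2 rfl ≪≫ shiftAddIso S (-2) 2 0 rfl ≪≫ shiftZeroIso S)
  have hX : t.IsGE (S⟦(-2 : ℤ)⟧⟦(1 : ℤ)⟧) 1 := by
    have := hS.isGE_shift (-2) 2
    exact t.isGE_shift _ 2 1 1
  suffices t.IsLE F 0 ∧ t.IsGE F 0 from ⟨this.1.le, this.2.ge⟩
  refine ⟨isLE_zero_of_homVanish_simple hB (ht F) fun T hTs m hm ↦ ?_,
    isGE_of_dist hT t 0 (isGE_sumShift hS1 _ fun j ↦ by have := hn j; lia) hG0⟩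
  by_cases hne : Nonempty (S ≅ T)
  · obtain ⟨i⟩ := hne
    exact (he.homVanish_to hD m fun j ↦ by have := hn j; lia).of_iso (Iso.refl _)
      ((shiftFunctor D m).mapIso i)
  have hTm := hTs.isGE_shift m (-m)
  have hGT : HomVanish G (T⟦m⟧) := by
    have : t.IsGE (T⟦m⟧) 1 := t.isGE_of_ge _ 1 (-m)
    rw [← homVanish_truncGE_iff t 1]
    intro f
    have hST : HomVanish (S⟦(-2 : ℤ)⟧⟦(1 : ℤ)⟧) (T⟦m⟧) :=
      (hS.homVanish_shift hTs hne (-1) m (by lia)).of_iso (shiftAddIso S (-2) 1 (-1) rfl).symm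
        (Iso.refl _)
    rw [← Category.id_comp f, hrs, Preadditive.sum_comp]
    exact Finset.sum_eq_zero fun i _ ↦ by rw [Category.assoc, hST (s i ≫ f), comp_zero]
  intro f
  have hef : e ≫ f = 0 := by
    refine hδ.eq_zero_of_retract ((t.truncGEπ 1).app G) r s hrs
      (fun u ↦ ⟨t.descTruncGE u 1, t.π_descTruncGE u 1⟩) (fun x hx ↦ ?_) (e ≫ f)
      (fun j hj ↦ hS.homVanish_shift hTs hne _ _ (by have := hn j; lia) _) ?_
    · refine eq_zero_of_comp_right (t.triangleLTGE_distinguished 1 G) ?_ x hx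
      have h0 : t.IsLE ((t.truncLT 1).obj G) 0 := t.isLE_truncLT_obj ..
      exact homVanish_of_isLE_of_isGE t (-1) (-m - 1) (t.isLE_shift _ 0 1 (-1))
        (t.isGE_shift _ (-m) 1 _) (by lia)
    · rw [Functor.map_comp, ← Category.assoc, dist_comp₃₁ hT, zero_comp]
  obtain ⟨f', rfl⟩ := exists_desc₂ hT f hef
  rw [hGT f', comp_zero]

/-- The twist of an object of the right tilt lies in the heart. -/
theorem heart_of_rightTilt (hD : IsTwoCalabiYau k D) (ht : ∀ X : D, t.bounded X)
    (hB : IsFiniteLengthHeart t) (hS : IsSimpleInHeart t S) (hsph : IsSpherical k S)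
    (hT : Triangle.mk e η δ ∈ distTriang D) (he : IsEvBasis e) (hF : rightTilt t S F) :
    t.heart G := by
  have hδ := he.isCoevBasis hD hsph hT
  have hS0 := hS.isLE
  have hS1 := hS.isGE
  have hT' : Triangle.mk η δ (-e⟦(1 : ℤ)⟧') ∈ distTriang D := rot_of_distTriang _ hT
  obtain ⟨hF0, hF1, hFS, hY⟩ := (rightTilt_iff t ht F).1 hF
  have hn : ∀ j, -1 ≤ n j ∧ n j ≤ 1 := by
    intro j
    have h := he.not_homVanish hsph j
    contrapose! h
    by_cases hj : -1 ≤ n j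
    · exact homVanish_of_isLE_of_isGE t (-n j) (-1) (hS.isLE_shift _ _) hF0
        (by have := h hj; lia)
    · rw [hD.homVanish_iff]
      by_cases hj1 : n j = -2
      · exact hFS.of_iso (Iso.refl _) (shiftAddIso S (n j) 2 0 (by lia) ≪≫ shiftZeroIso S).symm
      · have := hS.isGE_shift (n j) (-n j)
        exact homVanish_of_isLE_of_isGE t 0 (-n j - 2) hF1 (t.isGE_shift _ (-n j) 2 _) (by lia)
  obtain ⟨c, r, s, hrs⟩ := exists_id_eq_sum_of_shift (X := S⟦(1 : ℤ)⟧)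
    (hsph.eq_zero 1 (by lia) (by lia)) (-1) hY
    (shiftAddIso S 1 (-1) 0 rfl ≪≫ shiftZeroIso S)
  have hX : t.IsLE (S⟦(1 : ℤ)⟧) (-1) := hS.isLE_shift 1 (-1)
  have hP : t.IsLE (sumShift S n) 1 := isLE_sumShift hS0 1 fun j ↦ by have := hn j; lia
  suffices t.IsLE G 0 ∧ t.IsGE G 0 from ⟨this.1.le, this.2.ge⟩
  refine ⟨isLE_of_dist hT' t 0 hF1 (t.isLE_shift _ 1 1 0),
    isGE_zero_of_homVanish_simple hB (ht G) fun T hTs m hm ↦ ?_⟩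
  by_cases hne : Nonempty (T ≅ S)
  · obtain ⟨i⟩ := hne
    exact (hδ.homVanish_from hD m fun j ↦ by have := hn j; lia).of_iso
      ((shiftFunctor D m).mapIso i.symm) (Iso.refl _)
  have hTm := hTs.isLE_shift m (-m)
  have hTF : HomVanish (T⟦m⟧) F := by
    have : t.IsLE (T⟦m⟧) (-1) := t.isLE_of_le _ (-m) (-1)
    rw [← homVanish_truncLE_iff t (-1)]
    intro f
    have hTS := hTs.homVanish_shift hS hne m 1 (by lia)
    rw [← Category.comp_id f, hrs, Preadditive.comp_sum]
    exact Finset.sum_eq_zero fun i _ ↦ by rw [← Category.assoc, hTS (f ≫ r i), zero_comp]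
  intro u
  let i : T⟦m - 1⟧⟦(1 : ℤ)⟧ ≅ T⟦m⟧ := shiftAddIso T (m - 1) 1 m (by lia)
  obtain ⟨v, hv⟩ := (shiftFunctor D (1 : ℤ)).map_surjective (i.hom ≫ u ≫ δ)
  have hv0 : v = 0 := by
    refine he.eq_zero_of_retract ((t.truncLEι (-1)).app F) r s hrs
      (fun u ↦ ⟨t.liftTruncLE u (-1), t.liftTruncLE_ι u (-1)⟩) (fun x hx ↦ ?_) v
      (fun j hj ↦ hTs.homVanish_shift hS hne _ _ (by have := hn j; lia) _) ?_
    · refine eq_zero_of_comp_left (t.triangleLEGE_distinguished (-1) 0 (by lia) F) ?_ x hx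
      have h0 := hTs.isLE_shift (m - 1) (-(m - 1))
      exact homVanish_of_isLE_of_isGE t (-m) 0 (t.isLE_shift _ (-(m - 1)) 1 (-m))
        (t.isGE_truncGE_obj ..) (by lia)
    · apply (shiftFunctor D (1 : ℤ)).map_injective
      rw [Functor.map_comp, hv, Category.assoc, Category.assoc, dist_comp₃₁ hT, comp_zero,
        comp_zero, Functor.map_zero]
  have huδ : u ≫ δ = 0 := by
    rw [← cancel_epi i.hom, ← hv, hv0, Functor.map_zero, comp_zero]
  obtain ⟨u', rfl⟩ := exists_lift₂ hT u huδ
  rw [hTF u', zero_comp]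

end Tilting

/-! ### Images and preimages of the heart under the twist -/

section Equality

variable {k : Type*} [Field k] {D : Type*} [Category* D] [Preadditive D] [Linear k D]
  [HasZeroObject D] [HasShift D ℤ] [∀ n : ℤ, (shiftFunctor D n).Additive]
  [∀ n : ℤ, (shiftFunctor D n).Linear k] [Pretriangulated D] [IsTriangulated D]
  {t : TStructure D} {S : D}

theorem twistImage_heart (hD : IsTwoCalabiYau k D) (ht : ∀ X : D, t.bounded X)
    (hB : IsFiniteLengthHeart t) (hS : IsSimpleInHeart t S) (hsph : IsSpherical k S) :
    twistImage k S t.heart = leftTilt t S := by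
  ext G
  constructor
  · rintro ⟨F, hF, hFG⟩
    obtain ⟨J, _, n, e, he⟩ :=
      exists_isEvBasis_of_bounded hD hsph hS.isLE hS.isGE F (ht F)
    obtain ⟨η, δ, hT⟩ := hFG.exists_dist (he.isEvaluation hsph)
    exact leftTilt_of_isEvBasis hD ht hB hS hsph hT he hF
  · intro hG
    obtain ⟨J, _, n, δ, hδ⟩ :=
      exists_isCoevBasis_of_bounded hD hsph hS.isLE hS.isGE G (ht G)
    obtain ⟨F, e, η, hT⟩ := distinguished_cocone_triangle₂ δ
    exact ⟨F, heart_of_leftTilt hD ht hB hS hsph hT hδ hG, _, e, η, δ,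
      (hδ.isEvBasis hD hsph hT).isEvaluation hsph, hT⟩

theorem twistPreimage_heart (hD : IsTwoCalabiYau k D) (ht : ∀ X : D, t.bounded X)
    (hB : IsFiniteLengthHeart t) (hS : IsSimpleInHeart t S) (hsph : IsSpherical k S) :
    twistPreimage k S t.heart = rightTilt t S := by
  ext F
  obtain ⟨J, _, n, e, he⟩ :=
    exists_isEvBasis_of_bounded hD hsph hS.isLE hS.isGE F (ht F)
  constructor
  · rintro ⟨G, hG, hFG⟩
    obtain ⟨η, δ, hT⟩ := hFG.exists_dist (he.isEvaluation hsph)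
    exact rightTilt_of_isCoevBasis hD ht hB hS hsph hT (he.isCoevBasis hD hsph hT) hG
  · intro hF
    obtain ⟨G, η, δ, hT⟩ := distinguished_cocone_triangle e
    exact ⟨G, heart_of_rightTilt hD ht hB hS hsph hT he hF, _, e, η, δ,
      he.isEvaluation hsph, hT⟩

end Equality

/-! ### Autoequivalences given by the twist -/

section Equivalence

variable {k : Type*} [Field k] {D : Type*} [Category* D] [Preadditive D] [Linear k D]
  [HasZeroObject D] [HasShift D ℤ] [∀ n : ℤ, (shiftFunctor D n).Additive] [Pretriangulated D]
  {S : D}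

lemma map_functor_eq_twistImage (B : ObjectProperty D) (T : D ≌ D)
    (hT : ∀ F : D, IsTwist k S F (T.functor.obj F)) :
    B.map T.functor = twistImage k S B := by
  ext G
  rw [ObjectProperty.prop_map_iff]
  constructor
  · rintro ⟨F, hF, ⟨i⟩⟩
    exact ⟨F, hF, (hT F).of_iso i⟩
  · rintro ⟨F, hF, h⟩
    exact ⟨F, hF, (hT F).nonempty_iso h⟩

lemma map_inverse_eq_twistPreimage (B : ObjectProperty D) [B.IsClosedUnderIsomorphisms]
    (T : D ≌ D) (hT : ∀ F : D, IsTwist k S F (T.functor.obj F)) :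
    B.map T.inverse = twistPreimage k S B := by
  ext F
  rw [ObjectProperty.prop_map_iff]
  constructor
  · rintro ⟨G, hG, ⟨i⟩⟩
    exact ⟨_, B.prop_of_iso ((T.counitIso.app G).symm ≪≫ T.functor.mapIso i) hG, hT F⟩
  · rintro ⟨G, hG, h⟩
    obtain ⟨i⟩ := h.nonempty_iso (hT F)
    exact ⟨G, hG, ⟨T.inverse.mapIso i ≪≫ (T.unitIso.app F).symm⟩⟩

end Equivalence

end TwistTilt


theorem proposition5p7 {k : Type*} [Field k] {D : Type*} [Category* D] [Preadditive D]
    [Linear k D] [HasZeroObject D] [HasShift D ℤ] [∀ n : ℤ, (shiftFunctor D n).Additive]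
    [∀ n : ℤ, (shiftFunctor D n).Linear k] [Pretriangulated D] [IsTriangulated D]
    (hD : TwistTilt.IsTwoCalabiYau k D)
    (t : TStructure D) (ht : ∀ X : D, t.bounded X) (hB : TwistTilt.IsFiniteLengthHeart t)
    (S : D) (hS : TwistTilt.IsSimpleInHeart t S) (hsph : TwistTilt.IsSpherical k S) :
    -- the twist `T_S(F)` of any object `F` exists and is unique up to isomorphism
    (∀ F : D, ∃ G : D, TwistTilt.IsTwist k S F G) ∧
    (∀ F G G' : D, TwistTilt.IsTwist k S F G → TwistTilt.IsTwist k S F G' →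
      Nonempty (G ≅ G')) ∧
    -- `T_S(B) = L_S B` and `T_S⁻¹(B) = R_S B` for the operation `T_S` on objects
    TwistTilt.twistImage k S t.heart = TwistTilt.leftTilt t S ∧
    TwistTilt.twistPreimage k S t.heart = TwistTilt.rightTilt t S ∧
    -- the same for each autoequivalence `T` of `D` which is given on objects by the twist
    (∀ T : D ≌ D, (∀ F : D, TwistTilt.IsTwist k S F (T.functor.obj F)) →
      t.heart.map T.functor = TwistTilt.leftTilt t S ∧
      t.heart.map T.inverse = TwistTilt.rightTilt t S) := by
  have hex : ∀ F : D, ∃ G : D, TwistTilt.IsTwist k S F G := fun F ↦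
    TwistTilt.exists_isTwist hD hsph hS.isLE hS.isGE F (ht F)
  have hleft := TwistTilt.twistImage_heart hD ht hB hS hsph
  have hright := TwistTilt.twistPreimage_heart hD ht hB hS hsph
  refine ⟨hex, fun F G G' h h' ↦ h.nonempty_iso h', hleft, hright, fun T hT ↦ ⟨?_, ?_⟩⟩
  · rw [← hleft, TwistTilt.map_functor_eq_twistImage t.heart T hT]
  · rw [← hright, TwistTilt.map_inverse_eq_twistPreimage t.heart T hT]
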